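/- **Setting.** Let $(\mathcal Y,\mathcal E)$, $\mathcal E\subset\mathcal Y^2$, be a finite, nonempty, strongly connected digraph, $\kappa\colon\mathcal Y\to\mathcal X$ a surjection onto a finite set, $\mathcal S_x=\kappa^{-1}(x)$ for $x\in\mathcal X$, and $\mathcal D=\{(\kappa(y),\kappa(y')):(y,y')\in\mathcal E\}$. Functions $F\in\mathbb R^{\mathcal E}$ are identified with matrices vanishing outside $\mathcal E$, and $F(y,\mathcal S_{x'})=\sum_{y'\in\mathcal S_{x'}}F(y,y')$. * $\mathcal W(\mathcal Y,\mathcal E)$ is the set of row-stochastic matrices $P$ with $P(y,y')>0$ if and only if $(y,y')\in\mathcal E$. $\mathcal W_\kappa(\mathcal Y,\mathcal E)$ is the set of $\kappa$-lumpable $P\in\mathcal W(\mathcal Y,\mathcal E)$: there is a stochastic matrix $Q$ on $\mathcal X$ such that, for every initial distribution, if $(Y_t)$ is a Markov chain with transition matrix $P$, then $(\kappa(Y_t))$ is a Markov chain with transition matrix $Q$. Assume $\mathcal W_\kappa(\mathcal Y,\mathcal E)\ne\emptyset$. * $\mathcal N(\mathcal Y,\mathcal E)\subset\mathbb R^{\mathcal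 E}$ is the space of functions $(y,y')\mapsto f(y')-f(y)+c$, with $f\in\mathbb R^{\mathcal Y}$, $c\in\mathbb R$. * $\mathcal G_\kappa(\mathcal Y,\mathcal E)$ is the set of entrywise logarithms $\log F$ of positive functions $F\in\mathbb R^{\mathcal E}$ such that $F(y_1,\mathcal S_{x'})=F(y_2,\mathcal S_{x'})$ for all $(x,x')\in\mathcal D$ and $y_1,y_2\in\mathcal S_x$. * For positive $F\in\mathbb R^{\mathcal E}$ with Perron–Frobenius root $\rho$ and positive right eigenvector $v$, $\mathfrak s(F)(y,y')=F(y,y')v(y')/(\rho\,v(y))$. A set $\mathcal V\subset\mathcal W(\mathcal Y,\mathcal E)$ is an *e-family* if there are $d\ge0$, $K\in\mathbb R^{\mathcal E}$ and $G_1,\dots,G_d\in\mathbb R^{\mathcal E}$, linearly independent modulo $\mathcal N(\mathcal Y,\mathcal E)$, with $\mathcal V=\{\mathfrak s(\exp(K+\sum_i\theta^iG_i)):\theta\in\mathbb R^d\}$, where $\exp$ is entrywise. * For $(x,x')\in\mathcal D$ let $\mathcal M_{x,x'}$ be the set of $y\in\mathcal S_x$ having at least two edges into $\mathcal S_{x'}$.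 Let $\mathcal U=\{(x,x')\in\mathcal D:\mathcal M_{x,x'}\neq\mathcal S_x\}$ and $\mathcal R=\{(y,y')\in\mathcal E:y\in\mathcal M_{\kappa(y),\kappa(y')}\}$. An anchor choice selects, for each $(x,x')\in\mathcal D$ and each $y\in\mathcal S_x$, one edge from $y$ into $\mathcal S_{x'}$; $E_{x,x'}$ denotes the set of the $|\mathcal S_x|$ selected edges. **Theorem.** (1) $\mathcal W_\kappa(\mathcal Y,\mathcal E)$ is an e-family if and only if $$\dim\bigl(\operatorname{span}(\mathcal G_\kappa(\mathcal Y,\mathcal E))+\mathcal N(\mathcal Y,\mathcal E)\bigr)=|\mathcal E|+|\mathcal Y|+|\mathcal D|-|\mathcal X|-\sum_{(x,x')\in\mathcal D}|\mathcal S_x| .$$ (2) Anchor choices exist. For every anchor choice, the indicator functions of the sets $E_{x,x'}$, $(x,x')\in\mathcal U$, together with the indicator functions of the single edges in $\mathcal R$, form a basis of $\operatorname{span}(\mathcal G_\kappa(\mathcal Y,\mathcal E))$. For every $y_\star\in\mathcal Y$, the constant function $1$ together with the functions $(y,y')\mapsto\mathbf 1[y'=y_0]-\mathbf 1[y=y_0]$,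 $y_0\in\mathcal Y\setminus\{y_\star\}$, form a basis of $\mathcal N(\mathcal Y,\mathcal E)$. Consequently the e-family property is decided by a rank computation: $\mathcal W_\kappa(\mathcal Y,\mathcal E)$ is an e-family if and only if the matrix over $\mathbb Q$, with entries in $\{-1,0,1\}$, whose rows are these two systems concatenated, has rank equal to the right-hand side in (1). -/

import Mathlib

namespace Lumping

open Finset

/-! Functions on the edge set `E` are `E → ℝ`; they are identified with the matrices that vanish
outside `E` through `edgeMatrix`. -/

section Graph

variable {Y : Type*}

/-- Every vertex of the digraph `(Y, E)` is reachable from every vertex along directed edges. -/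
def StronglyConnected (E : Finset (Y × Y)) : Prop :=
  ∀ y y' : Y, Relation.ReflTransGen (fun a b => (a, b) ∈ E) y y'

variable [DecidableEq Y]

/-- The square matrix of a function on the edges, extended by `0` outside the edge set. -/
def edgeMatrix (E : Finset (Y × Y)) (F : E → ℝ) : Matrix Y Y ℝ :=
  fun y y' => if h : (y, y') ∈ E then F ⟨(y, y'), h⟩ else 0

/-- `𝒲(Y, E)`: the row-stochastic matrices `P` with `P(y, y') > 0` exactly when `(y, y') ∈ E`.
It is only used for strongly connected `(Y, E)`, where such matrices are irreducible. -/
def stochasticFamily [Fintype Y] (E : Finset (Y × Y)) : Set (E → ℝ) :=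
  {P | (∀ e, 0 < P e) ∧ edgeMatrix E P ∈ Matrix.rowStochastic ℝ Y}

/-- `𝒩(Y, E)`: the functions `(y, y') ↦ f y' - f y + c` on the edges. -/
def antiShift (E : Finset (Y × Y)) : Submodule ℝ (E → ℝ) where
  carrier := {N | ∃ (c : ℝ) (f : Y → ℝ), ∀ e : E, N e = f e.1.2 - f e.1.1 + c}
  zero_mem' := ⟨0, 0, fun e => by simp⟩
  add_mem' := by
    rintro N N' ⟨c, f, h⟩ ⟨c', f', h'⟩
    exact ⟨c + c', f + f', fun e => by simp only [Pi.add_apply, h, h']; ring⟩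
  smul_mem' := by
    rintro a N ⟨c, f, h⟩
    exact ⟨a * c, a • f, fun e => by simp only [Pi.smul_apply, smul_eq_mul, h]; ring⟩

/-- `(ρ, v)` is a right Perron-Frobenius eigenpair of `F`: a positive eigenvalue with an entrywise
positive right eigenvector. For positive `F` on a strongly connected nonempty graph, `ρ` is unique
and `v` is unique up to a positive factor. -/
def IsPerronPair [Fintype Y] (E : Finset (Y × Y)) (F : E → ℝ) (p : ℝ × (Y → ℝ)) : Prop :=
  0 < p.1 ∧ (∀ y, 0 < p.2 y) ∧ (edgeMatrix E F).mulVec p.2 = p.1 • p.2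

open Classical in
/-- The `𝔰`-normalization `F(y, y') v(y') / (ρ v(y))`, where `(ρ, v)` is a right Perron-Frobenius
eigenpair of `F`. -/
noncomputable def sNormalize [Fintype Y] (E : Finset (Y × Y)) (F : E → ℝ) : E → ℝ :=
  if h : ∃ p, IsPerronPair E F p then
    fun e => F e * h.choose.2 e.1.2 / (h.choose.1 * h.choose.2 e.1.1)
  else 0

/-- `V` is an exponential family of stochastic matrices: for some `d`, some function `K` and some
`G₁, …, G_d` that are linearly independent modulo `𝒩(Y, E)`, it is the set of all
`𝔰(exp(K + ∑ θⁱ Gᵢ))`, `θ ∈ ℝᵈ`. -/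
def IsEFamily [Fintype Y] (E : Finset (Y × Y)) (V : Set (E → ℝ)) : Prop :=
  ∃ (d : ℕ) (K : E → ℝ) (G : Fin d → E → ℝ),
    LinearIndependent ℝ (fun i => (antiShift E).mkQ (G i)) ∧
    V = Set.range (fun θ : Fin d → ℝ =>
      sNormalize E (fun e => Real.exp (K e + ∑ i, θ i * G i e)))

end Graph

section Lumpability

variable {X Y : Type*}

/-- The probability of the trajectory `z₀, …, z_n` for the Markov chain with initial
distribution `μ` and transition matrix `P`. -/
def pathProb {S : Type*} (μ : S → ℝ) (P : Matrix S S ℝ) {n : ℕ} (z : Fin (n + 1) → S) : ℝ :=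
  μ (z 0) * ∏ i : Fin n, P (z i.castSucc) (z i.succ)

variable [Fintype Y] [DecidableEq X]

/-- The fibre `S_x = κ⁻¹(x)`. -/
def fiber (κ : Y → X) (x : X) : Finset Y := univ.filter (fun y => κ y = x)

/-- `κ`-lumpability of a Markov chain on `Y` with transition matrix `P`: there is a transition
matrix `Q` on `X` such that, whatever the initial distribution `μ` of `(Y_t)`, the process
`(κ(Y_t))` is a time-homogeneous Markov chain with transition matrix `Q`, i.e. has its
finite-dimensional distributions. -/
def IsLumpable [Fintype X] (κ : Y → X) (P : Matrix Y Y ℝ) : Prop :=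
  ∃ Q ∈ Matrix.rowStochastic ℝ X, ∀ μ ∈ stdSimplex ℝ Y, ∀ (n : ℕ) (x : Fin (n + 1) → X),
    ∑ y : Fin (n + 1) → Y with (∀ i, κ (y i) = x i), pathProb μ P y =
      pathProb (fun a => ∑ y ∈ fiber κ a, μ y) Q x

variable [DecidableEq Y]

/-- `𝒲_κ(Y, E)`: the `κ`-lumpable members of `𝒲(Y, E)`. -/
def lumpableFamily [Fintype X] (E : Finset (Y × Y)) (κ : Y → X) : Set (E → ℝ) :=
  {P ∈ stochasticFamily E | IsLumpable κ (edgeMatrix E P)}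

/-- `D = κ(E)`, the lumped edge set. -/
def lumpedEdges (E : Finset (Y × Y)) (κ : Y → X) : Finset (X × X) := E.image (Prod.map κ κ)

/-- `ℱ_κ⁺(Y, E)`: the positive functions `F` on the edges such that, for `(x, x') ∈ D`, the sum
`F(y, S_{x'})` is the same for all `y ∈ S_x`. -/
def positiveLumpable (E : Finset (Y × Y)) (κ : Y → X) : Set (E → ℝ) :=
  {F | (∀ e, 0 < F e) ∧
    ∀ p ∈ lumpedEdges E κ, ∀ y₁ ∈ fiber κ p.1, ∀ y₂ ∈ fiber κ p.1,
      ∑ y' ∈ fiber κ p.2, edgeMatrix E F y₁ y' = ∑ y' ∈ fiber κ p.2, edgeMatrix E F y₂ y'}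

/-- `𝒢_κ(Y, E)`: the entrywise logarithms of the elements of `ℱ_κ⁺(Y, E)`. -/
def logLumpable (E : Finset (Y × Y)) (κ : Y → X) : Set (E → ℝ) :=
  (fun F e => Real.log (F e)) '' positiveLumpable E κ

/-- `M_{x,x'}`: the `y ∈ S_x` with at least two edges into `S_{x'}`. -/
def mergingRows (E : Finset (Y × Y)) (κ : Y → X) (x x' : X) : Finset Y :=
  (fiber κ x).filter fun y =>
    ∃ y₁ ∈ fiber κ x', ∃ y₂ ∈ fiber κ x', y₁ ≠ y₂ ∧ (y, y₁) ∈ E ∧ (y, y₂) ∈ E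

/-- `U`: the blocks `(x, x') ∈ D` in which some row is not merging. -/
def nonMergingBlocks (E : Finset (Y × Y)) (κ : Y → X) : Finset (X × X) :=
  (lumpedEdges E κ).filter fun p => mergingRows E κ p.1 p.2 ≠ fiber κ p.1

/-- `R`: the edges that lie in a merging row of their block. -/
def mergingEdges (E : Finset (Y × Y)) (κ : Y → X) : Finset (Y × Y) :=
  E.filter fun e => e.1 ∈ mergingRows E κ (κ e.1) (κ e.2)

/-- A choice of anchor edges: for every block `(x, x') ∈ D` and every `y ∈ S_x`, one edge
`(y, a y x')` of the graph with `a y x' ∈ S_{x'}`. -/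
def IsAnchorChoice (E : Finset (Y × Y)) (κ : Y → X) (a : Y → X → Y) : Prop :=
  ∀ p ∈ lumpedEdges E κ, ∀ y ∈ fiber κ p.1, (y, a y p.2) ∈ E ∧ a y p.2 ∈ fiber κ p.2

/-- The anchor edges `E_{x,x'}` of the block `(x, x')`. -/
def anchorEdges (κ : Y → X) (a : Y → X → Y) (x x' : X) : Finset (Y × Y) :=
  (fiber κ x).image fun y => (y, a y x')

/-- The system `ℬ_κ(Y, E)`: the indicators of `E_{x,x'}` for `(x, x') ∈ U` and of the single edges
in `R`. -/
def lumpableBasis (𝕜 : Type*) [Zero 𝕜] [One 𝕜] (E : Finset (Y × Y)) (κ : Y → X)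
    (a : Y → X → Y) : nonMergingBlocks E κ ⊕ mergingEdges E κ → E → 𝕜
  | Sum.inl p => fun e => if (e : Y × Y) ∈ anchorEdges κ a p.1.1 p.1.2 then 1 else 0
  | Sum.inr e₀ => fun e => if (e : Y × Y) = e₀ then 1 else 0

end Lumpability

/-- The constant function `1` and the functions `(y, y') ↦ 1[y' = y₀] - 1[y = y₀]` for
`y₀ ≠ yStar`. -/
def antiShiftBasis {Y : Type*} [DecidableEq Y] (𝕜 : Type*) [Zero 𝕜] [One 𝕜] [Sub 𝕜]
    (E : Finset (Y × Y)) (yStar : Y) : Option {y : Y // y ≠ yStar} → E → 𝕜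
  | none => fun _ => 1
  | some y₀ => fun e => (if e.1.2 = y₀.1 then 1 else 0) - (if e.1.1 = y₀.1 then 1 else 0)

/-- The rational matrix (with entries in `{-1, 0, 1}`) whose rows are the concatenation of the
systems `lumpableBasis` and `antiShiftBasis`. -/
def criterionMatrix {X Y : Type*} [Fintype Y] [DecidableEq X] [DecidableEq Y]
    (E : Finset (Y × Y)) (κ : Y → X) (a : Y → X → Y) (yStar : Y) :
    Matrix ((nonMergingBlocks E κ ⊕ mergingEdges E κ) ⊕ Option {y : Y // y ≠ yStar}) E ℚ :=
  Matrix.of (Sum.elim (lumpableBasis ℚ E κ a) (antiShiftBasis ℚ E yStar))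

end Lumping

open Lumping

/-!
For stochastic `P`, the equation `𝔰(exp w) = P` means that `w` and `log P` agree modulo
`𝒩 = antiShift E` (`sNormalize_exp_eq_iff`, a consequence of the uniqueness of Perron-Frobenius
eigenpairs). Hence `𝒲_κ` is an e-family exactly when `log 𝒲_κ + 𝒩` (`logSaturation`) is an affine
subspace (`isEFamily_iff`).

By the Kemeny-Snell criterion (`mem_lumpableFamily_iff`), `𝒲_κ` consists of the stochastic members
of `ℱ_κ⁺`, and conversely `𝔰` maps `ℱ_κ⁺` into `𝒲_κ`, because a Perron-Frobenius eigenvector of the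
lumped matrix pulls back to `Y` (`log_mem_logSaturation`). So `log 𝒲_κ + 𝒩 = 𝒢_κ + 𝒩`. The explicit
basis shows that already the differences of elements of `𝒢_κ` span `span 𝒢_κ`
(`span_logLumpable_le`); therefore `log 𝒲_κ + 𝒩`, if affine, is all of `span 𝒢_κ + 𝒩`
(`isEFamily_lumpableFamily_iff`).

It remains to compare dimensions (`forall_mem_logSaturation_iff`). The set `𝒲_κ` is relatively open
in an affine space with direction `tangentSpace E κ`, whose dimension is a rank-nullity count
(`finrank_tangentSpace`), and `(τ, n) ↦ log (P + τ) + n` parametrizes `log 𝒲_κ + 𝒩`. This map is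
smooth, so its image cannot fill a space of larger dimension. Its differential at `τ = 0` is
injective by the maximum principle (`logChartDeriv_injective`), so if the dimension of
`span 𝒢_κ + 𝒩` equals `dim 𝒲_κ + |Y|`, then `log 𝒲_κ + 𝒩` is open in `span 𝒢_κ + 𝒩`; it is also
closed, since normalized eigenvectors range over a compact simplex (`isClosed_logSaturation`), and
connectedness finishes the argument.
-/

namespace Lumping

open Finset

/-! ### Perron-Frobenius theory -/

section Perron

variable {Y : Type*} [DecidableEq Y] {E : Finset (Y × Y)}

lemma edgeMatrix_of_mem {y y' : Y} (h : (y, y') ∈ E) (F : E → ℝ) :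
    edgeMatrix E F y y' = F ⟨(y, y'), h⟩ := dif_pos h

lemma edgeMatrix_of_notMem {y y' : Y} (h : (y, y') ∉ E) (F : E → ℝ) :
    edgeMatrix E F y y' = 0 := dif_neg h

lemma edgeMatrix_nonneg {F : E → ℝ} (hF : ∀ e, 0 < F e) (y y' : Y) :
    0 ≤ edgeMatrix E F y y' := by
  unfold edgeMatrix
  split_ifs
  exacts [(hF _).le, le_rfl]

lemma edgeMatrix_pos_iff {F : E → ℝ} (hF : ∀ e, 0 < F e) {y y' : Y} :
    0 < edgeMatrix E F y y' ↔ (y, y') ∈ E := by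
  unfold edgeMatrix
  split_ifs with h <;> simp [h, hF]

variable [Fintype Y]

/-- The entries of `(1 + A) ^ k` are nondecreasing in `k`, and each one is eventually positive. -/
lemma exists_one_add_pow_pos {A : Matrix Y Y ℝ} (hA : ∀ y y', 0 ≤ A y y')
    (hconn : ∀ y y', Relation.ReflTransGen (fun a b => 0 < A a b) y y') :
    ∃ k : ℕ, ∀ y y', 0 < ((1 + A) ^ k : Matrix Y Y ℝ) y y' := by
  set B : ℕ → Matrix Y Y ℝ := fun k => (1 + A) ^ k
  have hmul : ∀ k y y', B (k + 1) y y' =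
      B k y y' + ∑ z, B k y z * A z y' := fun k y y' => by
    simp only [B]
    rw [pow_succ, mul_add, mul_one, Matrix.add_apply, Matrix.mul_apply]
  have hnn : ∀ k y y', 0 ≤ B k y y' := by
    intro k
    induction k with
    | zero =>
      intro y y'
      simp only [B]
      rw [pow_zero, Matrix.one_apply]
      split_ifs <;> norm_num
    | succ k ih =>
      intro y y'
      rw [hmul]
      exact add_nonneg (ih _ _) (sum_nonneg fun z _ => mul_nonneg (ih _ _) (hA _ _))
  have hmono : ∀ y y', Monotone fun k => B k y y' := fun y y' =>
    monotone_nat_of_le_succ fun k => by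
      rw [hmul]
      exact le_add_of_nonneg_right (sum_nonneg fun z _ => mul_nonneg (hnn _ _ _) (hA _ _))
  have hex : ∀ p : Y × Y, ∃ k : ℕ, 0 < B k p.1 p.2 := by
    rintro ⟨y, y'⟩
    induction hconn y y' with
    | refl => exact ⟨0, by simp [B]⟩
    | @tail b c _ hbc ih =>
      obtain ⟨k, hk⟩ := ih
      refine ⟨k + 1, ?_⟩
      rw [hmul]
      refine add_pos_of_nonneg_of_pos (hnn _ _ _) (sum_pos' (fun z _ =>
        mul_nonneg (hnn _ _ _) (hA _ _)) ⟨b, mem_univ _, mul_pos hk hbc⟩)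
  choose k hk using hex
  exact ⟨univ.sup k, fun y y' => (hk (y, y')).trans_le
    (hmono y y' (le_sup (f := k) (mem_univ (y, y'))))⟩

/-- Existence half of the Perron-Frobenius theorem, by the Collatz-Wielandt argument: a maximal
`r` admitting a nonnegative `v ≠ 0` with `r v ≤ A v` is an eigenvalue, since otherwise applying
the entrywise positive matrix `(1 + A) ^ k` to `v` would make the inequality strict. -/
lemma exists_pos_eigenvector [Nonempty Y] {A : Matrix Y Y ℝ} (hA : ∀ y y', 0 ≤ A y y')
    (hconn : ∀ y y', Relation.ReflTransGen (fun a b => 0 < A a b) y y') :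
    ∃ (r : ℝ) (v : Y → ℝ), 0 ≤ r ∧ (∀ y, 0 < v y) ∧ A.mulVec v = r • v := by
  obtain ⟨k, hk⟩ := exists_one_add_pow_pos hA hconn
  set B := (1 + A) ^ k with hB
  have hcomm : A * B = B * A := ((Commute.one_right A).add_right (Commute.refl A)).pow_right k
  have hBpos : ∀ z : Y → ℝ, (∀ y, 0 ≤ z y) → z ≠ 0 → ∀ y, 0 < B.mulVec z y := by
    intro z hz hz0 y
    obtain ⟨y', hy'⟩ := Function.ne_iff.mp hz0
    exact sum_pos' (fun i _ => mul_nonneg (hk _ _).le (hz _))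
      ⟨y', mem_univ _, mul_pos (hk _ _) (lt_of_le_of_ne (hz y') (Ne.symm hy'))⟩
  set M := ∑ y, ∑ y', A y y' with hM
  set K : Set (ℝ × (Y → ℝ)) :=
    (Set.Icc 0 M ×ˢ stdSimplex ℝ Y) ∩ {p | ∀ y, p.1 * p.2 y ≤ A.mulVec p.2 y} with hKdef
  have hbound : ∀ (r : ℝ), ∀ v ∈ stdSimplex ℝ Y, (∀ y, r * v y ≤ A.mulVec v y) → r ≤ M := by
    intro r v hv h
    calc r = ∑ y, r * v y := by rw [← mul_sum, hv.2, mul_one]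
      _ ≤ ∑ y, A.mulVec v y := sum_le_sum fun y _ => h y
      _ ≤ M := sum_le_sum fun y _ => sum_le_sum fun y' _ =>
          mul_le_of_le_one_right (hA _ _)
            (hv.2 ▸ single_le_sum (fun z _ => hv.1 z) (mem_univ y'))
  have hKc : IsCompact K := by
    refine (isCompact_Icc.prod (isCompact_stdSimplex ℝ Y)).inter_right ?_
    simp only [Set.ofPred_forall]
    refine isClosed_iInter fun y => isClosed_le ?_ ?_
    · fun_prop
    · simp only [Matrix.mulVec, dotProduct]
      fun_prop
  have hKne : K.Nonempty := by
    obtain ⟨y⟩ := ‹Nonempty Y›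
    have hs := single_mem_stdSimplex ℝ y
    refine ⟨(0, Pi.single y 1), ⟨⟨le_rfl, sum_nonneg fun _ _ => sum_nonneg fun _ _ => hA _ _⟩,
      hs⟩, fun y' => ?_⟩
    simp only [zero_mul]
    exact sum_nonneg fun z _ => mul_nonneg (hA _ _) (hs.1 z)
  obtain ⟨⟨r, v⟩, ⟨⟨hr, hv⟩, hle⟩, hmax⟩ := hKc.exists_isMaxOn hKne continuous_fst.continuousOn
  have hv0 : v ≠ 0 := by
    rintro rfl
    simpa using hv.2
  have hAv : A.mulVec v = r • v := by
    by_contra hne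
    have hz := hBpos (A.mulVec v - r • v) (fun y => sub_nonneg.mpr (hle y)) (sub_ne_zero.mpr hne)
    set w := B.mulVec v with hw
    have hwpos := hBpos v hv.1 hv0
    have hAw : ∀ y, r * w y < A.mulVec w y := fun y => by
      have := hz y
      rw [Matrix.mulVec_sub, Matrix.mulVec_mulVec, ← hcomm, ← Matrix.mulVec_mulVec,
        Matrix.mulVec_smul, ← hw] at this
      simpa using this
    obtain ⟨y₀, -, hy₀⟩ := exists_min_image univ (fun y => A.mulVec w y / w y) univ_nonempty
    set s := A.mulVec w y₀ / w y₀
    have hrs : r < s := (lt_div_iff₀ (hwpos y₀)).mpr (hAw y₀)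
    set t := ∑ y, w y
    have ht : 0 < t := sum_pos (fun y _ => hwpos y) univ_nonempty
    have hsimp : t⁻¹ • w ∈ stdSimplex ℝ Y := by
      refine ⟨fun y => mul_nonneg (inv_pos.mpr ht).le (hwpos y).le, ?_⟩
      simp only [Pi.smul_apply, smul_eq_mul, ← mul_sum]
      exact inv_mul_cancel₀ ht.ne'
    have hs : ∀ y, s * (t⁻¹ • w) y ≤ A.mulVec (t⁻¹ • w) y := fun y => by
      rw [Matrix.mulVec_smul, Pi.smul_apply, Pi.smul_apply, smul_eq_mul, smul_eq_mul,
        mul_left_comm]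
      exact mul_le_mul_of_nonneg_left ((le_div_iff₀ (hwpos y)).mp (hy₀ y (mem_univ y)))
        (inv_pos.mpr ht).le
    exact absurd (hmax (show (s, t⁻¹ • w) ∈ K from
      ⟨⟨⟨hr.1.trans hrs.le, hbound s _ hsimp hs⟩, hsimp⟩, hs⟩)) (not_le.mpr hrs)
  refine ⟨r, v, hr.1, fun y => ?_, hAv⟩
  have hpow : ∀ j : ℕ, ((1 + A) ^ j).mulVec v = (1 + r) ^ j • v := by
    intro j
    induction j with
    | zero => simp
    | succ j ih =>
      rw [pow_succ, ← Matrix.mulVec_mulVec, Matrix.add_mulVec, Matrix.one_mulVec, hAv,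
        show v + r • v = (1 + r) • v by rw [add_smul, one_smul], Matrix.mulVec_smul, ih,
        smul_smul, pow_succ']
  have h1 := hBpos v hv.1 hv0 y
  rw [hB, hpow] at h1
  exact pos_of_mul_pos_right h1 (pow_nonneg (add_nonneg zero_le_one hr.1) k)

lemma exists_isPerronPair [Nonempty Y] (hE : StronglyConnected E) (hne : E.Nonempty)
    {F : E → ℝ} (hF : ∀ e, 0 < F e) : ∃ p, IsPerronPair E F p := by
  obtain ⟨r, v, hr, hv, h⟩ := exists_pos_eigenvector (edgeMatrix_nonneg hF)
    (fun y y' => by simpa only [edgeMatrix_pos_iff hF] using hE y y')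
  refine ⟨(r, v), lt_of_le_of_ne hr ?_, hv, h⟩
  rintro rfl
  obtain ⟨⟨y, y'⟩, he⟩ := hne
  have h0 : (edgeMatrix E F).mulVec v y = 0 := by rw [h]; simp
  have : 0 < (edgeMatrix E F).mulVec v y :=
    sum_pos' (fun z _ => mul_nonneg (edgeMatrix_nonneg hF _ _) (hv z).le)
      ⟨y', mem_univ _, mul_pos ((edgeMatrix_pos_iff hF).mpr he) (hv y')⟩
  exact this.ne' h0

end Perron

/-! ### The `𝔰`-normalization modulo `𝒩(Y, E)` -/

section Normalization

variable {Y : Type*} [DecidableEq Y] {E : Finset (Y × Y)}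

lemma edgeMatrix_mul_apply (F : E → ℝ) (h : Y × Y → ℝ) (y y' : Y) :
    edgeMatrix E (fun e => F e * h e) y y' = edgeMatrix E F y y' * h (y, y') := by
  unfold edgeMatrix
  split_ifs <;> simp

variable [Fintype Y]

lemma sum_edgeMatrix_eq_one {P : E → ℝ} (hP : P ∈ stochasticFamily E) (y : Y) :
    ∑ y', edgeMatrix E P y y' = 1 := Matrix.sum_row_of_mem_rowStochastic hP.2 y

lemma nonempty_of_mem_stochasticFamily [Nonempty Y] {P : E → ℝ} (hP : P ∈ stochasticFamily E) :
    E.Nonempty := by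
  rw [nonempty_iff_ne_empty]
  rintro rfl
  obtain ⟨y⟩ := ‹Nonempty Y›
  have := sum_edgeMatrix_eq_one hP y
  simp [edgeMatrix] at this

/-- At a vertex where `g` is maximal, averaging does not increase `g`. -/
lemma exists_forall_ge_and_average_le [Nonempty Y] {P : E → ℝ} (hP : P ∈ stochasticFamily E)
    (g : Y → ℝ) : ∃ y, (∀ y', g y' ≤ g y) ∧ ∑ y', edgeMatrix E P y y' * g y' ≤ g y := by
  obtain ⟨y, -, hy⟩ := exists_max_image univ g univ_nonempty
  refine ⟨y, fun y' => hy y' (mem_univ _), ?_⟩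
  calc _ ≤ ∑ y', edgeMatrix E P y y' * g y := sum_le_sum fun y' _ =>
        mul_le_mul_of_nonneg_left (hy y' (mem_univ _)) (edgeMatrix_nonneg hP.1 _ _)
    _ = g y := by rw [← sum_mul, sum_edgeMatrix_eq_one hP, one_mul]

/-- Maximum principle: if averaging along an irreducible stochastic matrix shifts `f` by the
constant `c`, then `c = 0` and `f` is constant. -/
lemma const_of_average_eq_add [Nonempty Y] (hE : StronglyConnected E) {P : E → ℝ}
    (hP : P ∈ stochasticFamily E) {f : Y → ℝ} {c : ℝ}
    (h : ∀ y, ∑ y', edgeMatrix E P y y' * f y' = f y + c) : c = 0 ∧ ∀ y y', f y = f y' := by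
  obtain ⟨y₀, hmax, h₀⟩ := exists_forall_ge_and_average_le hP f
  obtain ⟨y₁, -, h₁⟩ := exists_forall_ge_and_average_le hP (fun y => -f y)
  simp only [mul_neg, sum_neg_distrib] at h₁
  rw [h] at h₀ h₁
  have hc : c = 0 := by linarith
  subst hc
  have hconst : ∀ y, f y = f y₀ := by
    intro y
    induction hE y₀ y with
    | refl => rfl
    | @tail a b _ hab ih =>
      have hsum : ∑ y', edgeMatrix E P a y' * (f y₀ - f y') = 0 := by
        simp only [mul_sub, sum_sub_distrib, ← sum_mul, sum_edgeMatrix_eq_one hP, h, ih]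
        ring
      have h2 := (sum_eq_zero_iff_of_nonneg fun y' _ =>
        mul_nonneg (edgeMatrix_nonneg hP.1 a y') (sub_nonneg.mpr (hmax y'))).mp hsum b (mem_univ b)
      rcases mul_eq_zero.mp h2 with h3 | h3
      · exact absurd h3 ((edgeMatrix_pos_iff hP.1).mpr hab).ne'
      · linarith
  exact ⟨rfl, fun y y' => (hconst y).trans (hconst y').symm⟩

/-- If `f(y') - f(y) + c` vanishes on all edges of an irreducible graph, then `c = 0` and `f` is
constant. The stochastic matrix only witnesses that every vertex has an outgoing edge. -/
lemma const_of_antiShift_eq_zero [Nonempty Y] (hE : StronglyConnected E)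
    (hne : (stochasticFamily E).Nonempty) {f : Y → ℝ} {c : ℝ}
    (h : ∀ e : E, f e.1.2 - f e.1.1 + c = 0) : c = 0 ∧ ∀ y y', f y = f y' := by
  obtain ⟨P, hP⟩ := hne
  have key := const_of_average_eq_add hE hP (f := f) (c := -c) fun y => by
    have : ∀ y', edgeMatrix E P y y' * f y' = edgeMatrix E P y y' * (f y + -c) := fun y' => by
      by_cases he : (y, y') ∈ E
      · have := h ⟨_, he⟩
        simp only at this
        rw [show f y' = f y + -c by linarith]
      · simp [edgeMatrix_of_notMem he]
    simp only [this, ← sum_mul, sum_edgeMatrix_eq_one hP, one_mul]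
  exact ⟨neg_eq_zero.mp key.1, key.2⟩

lemma normalize_mem_stochasticFamily {F : E → ℝ} (hF : ∀ e, 0 < F e) {p : ℝ × (Y → ℝ)}
    (hp : IsPerronPair E F p) :
    (fun e : E => F e * p.2 e.1.2 / (p.1 * p.2 e.1.1)) ∈ stochasticFamily E := by
  obtain ⟨hρ, hv, h⟩ := hp
  refine ⟨fun e => div_pos (mul_pos (hF e) (hv _)) (mul_pos hρ (hv _)), ?_⟩
  simp only [mul_div_assoc (F _)]
  rw [Matrix.mem_rowStochastic_iff_sum]
  have hm : ∀ y y', edgeMatrix E (fun e : E => F e * (p.2 e.1.2 / (p.1 * p.2 e.1.1))) y y' =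
      edgeMatrix E F y y' * (p.2 y' / (p.1 * p.2 y)) :=
    edgeMatrix_mul_apply F (fun q => p.2 q.2 / (p.1 * p.2 q.1))
  refine ⟨fun y y' => ?_, fun y => ?_⟩
  · rw [hm]
    exact mul_nonneg (edgeMatrix_nonneg hF _ _) (div_pos (hv _) (mul_pos hρ (hv _))).le
  · have h1 : ∑ y', edgeMatrix E F y y' * p.2 y' = p.1 * p.2 y := congrFun h y
    rw [sum_congr rfl fun y' _ => (hm y y').trans (mul_div_assoc _ _ _).symm, ← sum_div, h1]
    exact div_self (mul_pos hρ (hv y)).ne'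

/-- The normalization of `F` does not depend on the Perron-Frobenius eigenpair: the quotient of
two eigenvectors is an eigenvector of the normalized stochastic matrix, hence constant. -/
lemma normalize_eq_of_isPerronPair [Nonempty Y] (hE : StronglyConnected E) {F : E → ℝ}
    (hF : ∀ e, 0 < F e) {p q : ℝ × (Y → ℝ)} (hp : IsPerronPair E F p) (hq : IsPerronPair E F q)
    (e : E) : F e * q.2 e.1.2 / (q.1 * q.2 e.1.1) = F e * p.2 e.1.2 / (p.1 * p.2 e.1.1) := by
  have hP := normalize_mem_stochasticFamily hF hp
  obtain ⟨hρ, hv, h⟩ := hp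
  obtain ⟨hρ', hv', h'⟩ := hq
  set P : E → ℝ := fun e : E => F e * p.2 e.1.2 / (p.1 * p.2 e.1.1) with hPdef
  set g : Y → ℝ := fun y => q.2 y / p.2 y with hg
  have hgpos : ∀ y, 0 < g y := fun y => div_pos (hv' y) (hv y)
  have hPg : ∀ y, ∑ y', edgeMatrix E P y y' * g y' = q.1 / p.1 * g y := fun y => by
    have h1 : ∑ y', edgeMatrix E F y y' * q.2 y' = q.1 * q.2 y := congrFun h' y
    have h2 : ∀ y', edgeMatrix E P y y' * g y' =
        edgeMatrix E F y y' * q.2 y' / (p.1 * p.2 y) := fun y' => by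
      simp only [hPdef, mul_div_assoc]
      rw [edgeMatrix_mul_apply F (fun r => p.2 r.2 / (p.1 * p.2 r.1))]
      have := (hv y').ne'
      simp only [hg]
      field_simp
    rw [sum_congr rfl fun y' _ => h2 y', ← sum_div, h1]
    simp only [hg]
    rw [div_mul_div_comm]
  have hle : q.1 / p.1 ≤ 1 := by
    obtain ⟨y, -, hy⟩ := exists_forall_ge_and_average_le hP g
    rw [hPg] at hy
    exact le_of_mul_le_mul_right (hy.trans_eq (one_mul _).symm) (hgpos y)
  have hge : 1 ≤ q.1 / p.1 := by
    obtain ⟨y, -, hy⟩ := exists_forall_ge_and_average_le hP (fun y => -g y)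
    simp only [mul_neg, sum_neg_distrib] at hy
    rw [hPg] at hy
    exact le_of_mul_le_mul_right ((one_mul _).trans_le (neg_le_neg_iff.mp hy)) (hgpos y)
  have h1 : q.1 / p.1 = 1 := le_antisymm hle hge
  have hconst := (const_of_average_eq_add hE hP (f := g) (c := 0) fun y => by
    rw [hPg, h1, one_mul, add_zero]).2 e.1.1 e.1.2
  rw [div_eq_one_iff_eq hρ.ne'] at h1
  simp only [hg] at hconst
  rw [div_eq_div_iff (hv _).ne' (hv _).ne'] at hconst
  rw [h1, div_eq_div_iff (mul_pos hρ (hv' _)).ne' (mul_pos hρ (hv _)).ne']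
  linear_combination (-F e * p.1) * hconst

lemma sNormalize_eq [Nonempty Y] (hE : StronglyConnected E) {F : E → ℝ} (hF : ∀ e, 0 < F e)
    {p : ℝ × (Y → ℝ)} (hp : IsPerronPair E F p) :
    sNormalize E F = fun e => F e * p.2 e.1.2 / (p.1 * p.2 e.1.1) := by
  have hex : ∃ p, IsPerronPair E F p := ⟨p, hp⟩
  unfold sNormalize
  rw [dif_pos hex]
  exact funext fun e => normalize_eq_of_isPerronPair hE hF hp hex.choose_spec e

lemma log_normalize_sub_mem_antiShift {F : E → ℝ} (hF : ∀ e, 0 < F e) {p : ℝ × (Y → ℝ)}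
    (hp : IsPerronPair E F p) :
    (fun e : E => Real.log (F e) - Real.log (F e * p.2 e.1.2 / (p.1 * p.2 e.1.1))) ∈
      antiShift E := by
  refine ⟨Real.log p.1, fun y => -Real.log (p.2 y), fun e => ?_⟩
  beta_reduce
  rw [Real.log_div (mul_pos (hF e) (hp.2.1 _)).ne' (mul_pos hp.1 (hp.2.1 _)).ne',
    Real.log_mul (hF e).ne' (hp.2.1 _).ne', Real.log_mul hp.1.ne' (hp.2.1 _).ne']
  ring

lemma exists_isPerronPair_of_sub_log_mem {P : E → ℝ} (hP : P ∈ stochasticFamily E) {w : E → ℝ}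
    (h : (w - fun e => Real.log (P e)) ∈ antiShift E) :
    ∃ p, IsPerronPair E (fun e => Real.exp (w e)) p ∧
      ∀ e : E, Real.exp (w e) * p.2 e.1.2 / (p.1 * p.2 e.1.1) = P e := by
  obtain ⟨c, f, h⟩ := h
  have hw : ∀ e, Real.exp (w e) =
      P e * (Real.exp (f e.1.2) * Real.exp (-f e.1.1) * Real.exp c) := fun e => by
    have h1 := h e
    simp only [Pi.sub_apply] at h1
    rw [show w e = Real.log (P e) + (f e.1.2 + -f e.1.1 + c) by linarith, Real.exp_add,
      Real.exp_log (hP.1 e), Real.exp_add, Real.exp_add]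
  refine ⟨(Real.exp c, fun y => Real.exp (-f y)),
    ⟨Real.exp_pos _, fun y => Real.exp_pos _, ?_⟩, fun e => ?_⟩
  · ext y
    simp only [hw]
    change ∑ y', _ * _ = Real.exp c * Real.exp (-f y)
    have h2 : ∀ y', edgeMatrix E (fun e => P e *
        (Real.exp (f e.1.2) * Real.exp (-f e.1.1) * Real.exp c)) y y' * Real.exp (-f y') =
        edgeMatrix E P y y' * (Real.exp c * Real.exp (-f y)) := fun y' => by
      rw [edgeMatrix_mul_apply P
        (fun q => Real.exp (f q.2) * Real.exp (-f q.1) * Real.exp c)]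
      have := (Real.exp_pos (f y')).ne'
      simp only [Real.exp_neg]
      field_simp
    simp only [h2, ← sum_mul, sum_edgeMatrix_eq_one hP, one_mul]
  · simp only [hw, Real.exp_neg]
    have := (Real.exp_pos (f e.1.1)).ne'
    have := (Real.exp_pos (f e.1.2)).ne'
    have := (Real.exp_pos c).ne'
    field_simp

/-- `𝔰(exp w) = P` if and only if `w` and `log P` agree modulo `𝒩(Y, E)`. -/
lemma sNormalize_exp_eq_iff [Nonempty Y] (hE : StronglyConnected E) {P : E → ℝ}
    (hP : P ∈ stochasticFamily E) (w : E → ℝ) :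
    sNormalize E (fun e => Real.exp (w e)) = P ↔
      (w - fun e => Real.log (P e)) ∈ antiShift E := by
  have hpos : ∀ e : E, 0 < Real.exp (w e) := fun e => Real.exp_pos _
  constructor
  · rintro rfl
    -- Without an eigenpair the normalization would be `0`, which is not stochastic.
    have hex : ∃ p, IsPerronPair E (fun e => Real.exp (w e)) p := by
      by_contra hno
      unfold sNormalize at hP
      rw [dif_neg hno] at hP
      obtain ⟨y⟩ := ‹Nonempty Y›
      have := sum_edgeMatrix_eq_one hP y
      simp [edgeMatrix] at this
    obtain ⟨p, hp⟩ := hex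
    rw [sNormalize_eq hE hpos hp]
    have h := log_normalize_sub_mem_antiShift hpos hp
    simp only [Real.log_exp] at h
    exact h
  · intro h
    obtain ⟨p, hp, hpP⟩ := exists_isPerronPair_of_sub_log_mem hP h
    rw [sNormalize_eq hE hpos hp]
    exact funext hpP

/-- The functions whose exponential is normalized into `V`: the sum set `log V + 𝒩(Y, E)`. -/
def logSaturation (E : Finset (Y × Y)) (V : Set (E → ℝ)) : Set (E → ℝ) :=
  {w | ∃ P ∈ V, (w - fun e => Real.log (P e)) ∈ antiShift E}

/-- A set of stochastic matrices is an e-family exactly when `log V + 𝒩(Y, E)` is an affine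
subspace. -/
lemma isEFamily_iff [Nonempty Y] (hE : StronglyConnected E) {V : Set (E → ℝ)}
    (hV : V ⊆ stochasticFamily E) :
    IsEFamily E V ↔ ∃ (K : E → ℝ) (D : Submodule ℝ (E → ℝ)), antiShift E ≤ D ∧
      ∀ w, w ∈ logSaturation E V ↔ w - K ∈ D := by
  constructor
  · rintro ⟨d, K, G, -, hVeq⟩
    refine ⟨K, Submodule.span ℝ (Set.range G) ⊔ antiShift E, le_sup_right, fun w => ?_⟩
    have hiff : ∀ θ : Fin d → ℝ, ∀ P ∈ stochasticFamily E,
        sNormalize E (fun e => Real.exp (K e + ∑ i, θ i * G i e)) = P ↔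
        (K + ∑ i, θ i • G i - fun e => Real.log (P e)) ∈ antiShift E := fun θ P hP => by
      rw [← sNormalize_exp_eq_iff hE hP]
      simp
    rw [Submodule.mem_sup]
    constructor
    · rintro ⟨P, hPV, hw⟩
      have hP := hV hPV
      rw [hVeq] at hPV
      obtain ⟨θ, hθ⟩ := hPV
      refine ⟨∑ i, θ i • G i, Submodule.sum_mem _ fun i _ => Submodule.smul_mem _ _
        (Submodule.subset_span ⟨i, rfl⟩), _, (antiShift E).sub_mem hw ((hiff θ P hP).mp hθ), ?_⟩
      abel
    · rintro ⟨g, hg, n, hn, hgn⟩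
      obtain ⟨θ, rfl⟩ := (Submodule.mem_span_range_iff_exists_fun ℝ).mp hg
      have hPV : sNormalize E (fun e => Real.exp (K e + ∑ i, θ i * G i e)) ∈ V := by
        rw [hVeq]
        exact ⟨θ, rfl⟩
      refine ⟨_, hPV, ?_⟩
      have := (antiShift E).add_mem ((hiff θ _ (hV hPV)).mp rfl) hn
      convert this using 1
      rw [← sub_add_cancel w K, ← hgn]
      abel
  · rintro ⟨K, D, hD, hmem⟩
    -- The `Gᵢ` lift a basis of `D / 𝒩`.
    let W := D.map (antiShift E).mkQ
    let b := Module.finBasis ℝ W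
    choose G hG using fun i => Submodule.mem_map.mp (b i).2
    refine ⟨_, K, G, ?_, ?_⟩
    · simp only [hG]
      exact b.linearIndependent.map' W.subtype (Submodule.ker_subtype _)
    · have hsum : ∀ θ : Fin (Module.finrank ℝ W) → ℝ, ∀ e,
          K e + ∑ i, θ i * G i e = (K + ∑ i, θ i • G i) e := fun θ e => by simp
      simp only [hsum]
      ext P
      constructor
      · intro hPV
        have h1 : (fun e => Real.log (P e)) - K ∈ D :=
          (hmem _).mp ⟨P, hPV, by rw [sub_self]; exact zero_mem _⟩
        let u : W := ⟨(antiShift E).mkQ _, Submodule.mem_map_of_mem h1⟩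
        refine ⟨b.repr u, (sNormalize_exp_eq_iff hE (hV hPV) _).mpr ?_⟩
        have h2 : ∑ i, b.repr u i • (b i : (E → ℝ) ⧸ antiShift E) =
            (antiShift E).mkQ ((fun e => Real.log (P e)) - K) := by
          have := congrArg W.subtype (b.sum_repr u)
          rwa [map_sum] at this
        refine (Submodule.Quotient.mk_eq_zero _).mp ?_
        rw [← Submodule.mkQ_apply]
        simp only [map_sub, map_add, map_sum, map_smul, hG] at h2 ⊢
        rw [h2]
        abel
      · rintro ⟨θ, rfl⟩
        have h1 : K + ∑ i, θ i • G i - K ∈ D := by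
          rw [add_sub_cancel_left]
          exact D.sum_mem fun i _ => D.smul_mem _ (hG i).1
        obtain ⟨P, hPV, hP⟩ := (hmem _).mpr h1
        simp only
        rwa [(sNormalize_exp_eq_iff hE (hV hPV) _).mpr hP]

end Normalization

/-! ### Lumpability -/

section Lumpability

variable {X Y : Type*} [DecidableEq X]

lemma mem_lumpedEdges_of_mem {E : Finset (Y × Y)} {κ : Y → X} {y y' : Y} (h : (y, y') ∈ E) :
    (κ y, κ y') ∈ lumpedEdges E κ :=
  mem_image.mpr ⟨(y, y'), h, rfl⟩

lemma stronglyConnected_lumpedEdges {E : Finset (Y × Y)} {κ : Y → X}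
    (hE : StronglyConnected E) (hκ : Function.Surjective κ) :
    StronglyConnected (lumpedEdges E κ) := by
  intro x x'
  obtain ⟨y, rfl⟩ := hκ x
  obtain ⟨y', rfl⟩ := hκ x'
  exact (hE y y').lift κ fun a b hab => mem_lumpedEdges_of_mem hab

variable [Fintype Y]

lemma mem_fiber {κ : Y → X} {x : X} {y : Y} : y ∈ fiber κ x ↔ κ y = x := by simp [fiber]

lemma sum_fiber_sum [Fintype X] (κ : Y → X) (g : Y → ℝ) :
    ∑ x, ∑ y ∈ fiber κ x, g y = ∑ y, g y := sum_fiberwise univ κ g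

/-- If every row of `P` in the fibre over `x` has the same mass `Q x x'` in the fibre over `x'`,
then path probabilities of the lumped process factorize through `Q`. -/
lemma sum_pathProb_eq {κ : Y → X} {P : Matrix Y Y ℝ} {Q : Matrix X X ℝ}
    (h : ∀ y x', ∑ y' ∈ fiber κ x', P y y' = Q (κ y) x') (n : ℕ) :
    ∀ (μ : Y → ℝ) (x : Fin (n + 1) → X),
      ∑ y : Fin (n + 1) → Y with (∀ i, κ (y i) = x i), pathProb μ P y =
        pathProb (fun a => ∑ y ∈ fiber κ a, μ y) Q x := by
  induction n with
  | zero =>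
    intro μ x
    simp only [pathProb, univ_eq_empty, prod_empty, mul_one]
    refine sum_equiv (Equiv.funUnique (Fin 1) Y) (fun y => ?_) (fun y _ => rfl)
    simp [mem_fiber, Fin.forall_fin_one]
  | succ n ih =>
    intro μ x
    have hcons : ∑ y : Fin (n + 1 + 1) → Y with (∀ i, κ (y i) = x i), pathProb μ P y =
        ∑ z : Fin (n + 1) → Y with (∀ i, κ (z i) = x i.succ),
          ∑ y₀ ∈ fiber κ (x 0), pathProb μ P (Fin.cons y₀ z) := by
      rw [sum_comm, ← sum_product']
      symm
      refine sum_equiv (Fin.consEquiv fun _ => Y) (fun p => ?_) (fun p _ => rfl)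
      simp [mem_fiber, Fin.forall_fin_succ (n := n + 1), Fin.consEquiv]
    have hstep : ∀ z : Fin (n + 1) → Y, ∑ y₀ ∈ fiber κ (x 0), pathProb μ P (Fin.cons y₀ z) =
        pathProb (fun y' => ∑ y₀ ∈ fiber κ (x 0), μ y₀ * P y₀ y') P z := fun z => by
      simp only [pathProb, sum_mul]
      refine sum_congr rfl fun y₀ _ => ?_
      rw [Fin.prod_univ_succ]
      simp [mul_assoc]
    rw [hcons, sum_congr rfl fun z _ => hstep z, ih]
    simp only [pathProb]
    rw [Fin.prod_univ_succ, ← mul_assoc, sum_comm]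
    have : ∑ y₀ ∈ fiber κ (x 0), ∑ y ∈ fiber κ (x (Fin.succ 0)), μ y₀ * P y₀ y =
        (∑ y ∈ fiber κ (x 0), μ y) * Q (x 0) (x (Fin.succ 0)) := by
      rw [sum_mul]
      refine sum_congr rfl fun y₀ hy₀ => ?_
      rw [← mul_sum, h, mem_fiber.mp hy₀]
    rw [this]
    rfl

variable [DecidableEq Y]

/-- The sum of the row of `F` at `y` over the fibre of `x'`. -/
noncomputable def blockSum (E : Finset (Y × Y)) (κ : Y → X) (y : Y) (x' : X) :
    (E → ℝ) →ₗ[ℝ] ℝ where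
  toFun F := ∑ y' ∈ fiber κ x', edgeMatrix E F y y'
  map_add' F G := by
    rw [← sum_add_distrib]
    refine sum_congr rfl fun y' _ => ?_
    unfold edgeMatrix
    split_ifs <;> simp
  map_smul' c F := by
    rw [RingHom.id_apply, smul_eq_mul, mul_sum]
    refine sum_congr rfl fun y' _ => ?_
    unfold edgeMatrix
    split_ifs <;> simp

variable {E : Finset (Y × Y)} {κ : Y → X}

lemma blockSum_apply (F : E → ℝ) (y : Y) (x' : X) :
    blockSum E κ y x' F = ∑ y' ∈ fiber κ x', edgeMatrix E F y y' := rfl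

lemma sum_blockSum [Fintype X] (F : E → ℝ) (y : Y) :
    ∑ x', blockSum E κ y x' F = ∑ y', edgeMatrix E F y y' := sum_fiber_sum κ _

lemma blockSum_of_notMem (F : E → ℝ) {y : Y} {x' : X} (h : (κ y, x') ∉ lumpedEdges E κ) :
    blockSum E κ y x' F = 0 := by
  rw [blockSum_apply]
  refine sum_eq_zero fun y' hy' => edgeMatrix_of_notMem (fun he => h ?_) F
  exact mem_image.mpr ⟨(y, y'), he, by simp [mem_fiber.mp hy']⟩

lemma blockSum_pos {F : E → ℝ} (hF : ∀ e, 0 < F e) {y y' : Y} (h : (y, y') ∈ E) :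
    0 < blockSum E κ y (κ y') F :=
  sum_pos' (fun _ _ => edgeMatrix_nonneg hF _ _)
    ⟨y', mem_fiber.mpr rfl, (edgeMatrix_pos_iff hF).mpr h⟩

lemma mem_positiveLumpable_iff {F : E → ℝ} : F ∈ positiveLumpable E κ ↔
    (∀ e, 0 < F e) ∧ ∀ y₁ y₂ x', κ y₁ = κ y₂ → blockSum E κ y₁ x' F = blockSum E κ y₂ x' F := by
  refine and_congr_right fun _ => ⟨fun h y₁ y₂ x' hy => ?_, fun h p _ y₁ h₁ y₂ h₂ => ?_⟩
  · by_cases hp : (κ y₁, x') ∈ lumpedEdges E κ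
    · exact h _ hp y₁ (mem_fiber.mpr rfl) y₂ (mem_fiber.mpr hy.symm)
    · rw [blockSum_of_notMem F hp, blockSum_of_notMem F (hy ▸ hp)]
  · exact h y₁ y₂ p.2 ((mem_fiber.mp h₁).trans (mem_fiber.mp h₂).symm)

/-- The Kemeny-Snell criterion. -/
lemma mem_lumpableFamily_iff [Fintype X] (hκ : Function.Surjective κ) {P : E → ℝ} :
    P ∈ lumpableFamily E κ ↔ P ∈ stochasticFamily E ∧ P ∈ positiveLumpable E κ := by
  refine and_congr_right fun hP => ?_
  rw [mem_positiveLumpable_iff, and_iff_right hP.1]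
  constructor
  · rintro ⟨Q, -, hQ⟩
    -- Start the chain at `y` and look at the first step.
    have key : ∀ y x', blockSum E κ y x' P = Q (κ y) x' := fun y x' => by
      have h := hQ (Pi.single y 1) (single_mem_stdSimplex ℝ y) 1 ![κ y, x']
      have hl : ∑ z : Fin (1 + 1) → Y with (∀ i, κ (z i) = ![κ y, x'] i),
          pathProb (Pi.single y 1) (edgeMatrix E P) z = blockSum E κ y x' P := by
        have h1 : ∑ z : Fin (1 + 1) → Y with (∀ i, κ (z i) = ![κ y, x'] i),
            pathProb (Pi.single y 1) (edgeMatrix E P) z =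
            ∑ q ∈ fiber κ (κ y) ×ˢ fiber κ x', (Pi.single y 1 : Y → ℝ) q.1 * edgeMatrix E P q.1 q.2 := by
          refine sum_equiv (finTwoArrowEquiv Y) (fun z => ?_) (fun z _ => ?_)
          · simp [mem_fiber, Fin.forall_fin_two]
          · simp [pathProb]
        rw [h1, sum_product, sum_eq_single y]
        · simp [blockSum_apply]
        · intro b _ hb
          simp [Pi.single_eq_of_ne hb]
        · intro hy
          exact absurd (mem_fiber.mpr rfl) hy
      have hr : pathProb (fun a => ∑ z ∈ fiber κ a, (Pi.single y 1 : Y → ℝ) z) Q ![κ y, x'] =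
          Q (κ y) x' := by
        simp [pathProb, sum_pi_single', mem_fiber]
      rw [← hl, ← hr]
      exact h
    intro y₁ y₂ x' hy
    rw [key, key, hy]
  · intro h
    choose s hs using hκ
    have hQ : ∀ y x', blockSum E κ y x' P = blockSum E κ (s (κ y)) x' P := fun y x' =>
      h _ _ _ (hs _).symm
    refine ⟨fun x x' => blockSum E κ (s x) x' P, Matrix.mem_rowStochastic_iff_sum.mpr
      ⟨fun x x' => sum_nonneg fun _ _ => edgeMatrix_nonneg hP.1 _ _, fun x => ?_⟩,
      fun μ _ n x => sum_pathProb_eq hQ n μ x⟩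
    rw [sum_blockSum, sum_edgeMatrix_eq_one hP]

lemma exists_edge_of_mem_lumpedEdges {F : E → ℝ} (hF : F ∈ positiveLumpable E κ) {y : Y} {x' : X}
    (h : (κ y, x') ∈ lumpedEdges E κ) : ∃ y', (y, y') ∈ E ∧ κ y' = x' := by
  rw [mem_positiveLumpable_iff] at hF
  obtain ⟨⟨z, z'⟩, he, hz⟩ := mem_image.mp h
  obtain ⟨hz1, rfl⟩ := Prod.mk.inj hz
  have hpos := blockSum_pos (κ := κ) hF.1 he
  rw [hF.2 z y (κ z') hz1, blockSum_apply] at hpos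
  obtain ⟨y', hy', h'⟩ := exists_lt_of_sum_lt (f := fun _ => (0 : ℝ)) (by simpa using hpos)
  exact ⟨y', (edgeMatrix_pos_iff hF.1).mp h', mem_fiber.mp hy'⟩

/-- The `𝔰`-normalization maps `ℱ_κ⁺` into `𝒲_κ`, because a Perron-Frobenius eigenvector of the
lumped matrix pulls back along `κ` to one of `F`. -/
lemma log_mem_logSaturation [Fintype X] [Nonempty Y] (hE : StronglyConnected E)
    (hκ : Function.Surjective κ) (hne : E.Nonempty) {F : E → ℝ} (hF : F ∈ positiveLumpable E κ) :
    (fun e => Real.log (F e)) ∈ logSaturation E (lumpableFamily E κ) := by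
  have hF' := hF
  rw [mem_positiveLumpable_iff] at hF'
  obtain ⟨hpos, hblock⟩ := hF'
  choose s hs using id hκ
  have : Nonempty X := ‹Nonempty Y›.map κ
  let Q : lumpedEdges E κ → ℝ := fun p => blockSum E κ (s p.1.1) p.1.2 F
  have hQ : ∀ p, 0 < Q p := by
    rintro ⟨⟨x, x'⟩, hp⟩
    obtain ⟨y', hy', rfl⟩ := exists_edge_of_mem_lumpedEdges hF (y := s x) ((hs x).symm ▸ hp)
    exact blockSum_pos hpos hy'
  have hQm : ∀ y x', edgeMatrix (lumpedEdges E κ) Q (κ y) x' = blockSum E κ y x' F := by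
    intro y x'
    by_cases hp : (κ y, x') ∈ lumpedEdges E κ
    · rw [edgeMatrix_of_mem hp]
      exact hblock _ _ _ (hs _)
    · rw [edgeMatrix_of_notMem hp, blockSum_of_notMem F hp]
  obtain ⟨⟨ρ, v⟩, hρ, hv, hev⟩ :=
    exists_isPerronPair (stronglyConnected_lumpedEdges hE hκ) (hne.image _) hQ
  have hev' : ∀ y, ∑ x', blockSum E κ y x' F * v x' = ρ * v (κ y) := fun y => by
    have h : ∑ x', edgeMatrix (lumpedEdges E κ) Q (κ y) x' * v x' = ρ * v (κ y) :=
      congrFun hev (κ y)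
    simpa only [hQm] using h
  have hp : IsPerronPair E F (ρ, fun y => v (κ y)) := by
    refine ⟨hρ, fun y => hv _, ?_⟩
    ext y
    change ∑ y', edgeMatrix E F y y' * v (κ y') = ρ * v (κ y)
    rw [← hev', ← sum_fiber_sum κ]
    refine sum_congr rfl fun x' _ => ?_
    rw [blockSum_apply, sum_mul]
    exact sum_congr rfl fun y' hy' => by rw [mem_fiber.mp hy']
  refine ⟨_, (mem_lumpableFamily_iff hκ).mpr ⟨normalize_mem_stochasticFamily hpos hp,
    mem_positiveLumpable_iff.mpr ⟨(normalize_mem_stochasticFamily hpos hp).1, ?_⟩⟩,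
    log_normalize_sub_mem_antiShift hpos hp⟩
  have hb : ∀ y x', blockSum E κ y x'
      (fun e : E => F e * v (κ e.1.2) / (ρ * v (κ e.1.1))) =
      blockSum E κ y x' F * (v x' / (ρ * v (κ y))) := fun y x' => by
    rw [blockSum_apply, blockSum_apply, sum_mul]
    simp only [mul_div_assoc (F _)]
    refine sum_congr rfl fun y' hy' => ?_
    rw [edgeMatrix_mul_apply F (fun q => v (κ q.2) / (ρ * v (κ q.1))), mem_fiber.mp hy']
  intro y₁ y₂ x' hy
  rw [hb, hb, hblock y₁ y₂ x' hy, hy]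

end Lumpability

/-! ### The basis of the span of `𝒢_κ` -/

section LumpableBasis

variable {X Y : Type*} [Fintype Y] [DecidableEq X] [DecidableEq Y] {E : Finset (Y × Y)} {κ : Y → X}

lemma mem_mergingEdges_iff {y y' : Y} (h : (y, y') ∈ E) :
    (y, y') ∈ mergingEdges E κ ↔ ∃ z, (y, z) ∈ E ∧ κ z = κ y' ∧ z ≠ y' := by
  simp only [mergingEdges, mergingRows, mem_filter, mem_fiber, h, true_and]
  constructor
  · rintro ⟨y₁, h₁, y₂, h₂, hne, he₁, he₂⟩
    by_cases hy : y₁ = y'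
    · exact ⟨y₂, he₂, h₂, fun h' => hne (hy.trans h'.symm)⟩
    · exact ⟨y₁, he₁, h₁, hy⟩
  · rintro ⟨z, hz, hκz, hne⟩
    exact ⟨z, hκz, y', rfl, hne, hz, h⟩

lemma blockSum_of_notMem_mergingEdges {F : E → ℝ} {y y' : Y} (h : (y, y') ∈ E)
    (hR : (y, y') ∉ mergingEdges E κ) : blockSum E κ y (κ y') F = F ⟨(y, y'), h⟩ := by
  rw [blockSum_apply, sum_eq_single y', edgeMatrix_of_mem h]
  · intro z hz hne
    refine edgeMatrix_of_notMem (fun hE => hR ?_) F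
    exact (mem_mergingEdges_iff h).mpr ⟨z, hE, mem_fiber.mp hz, hne⟩
  · exact fun h' => absurd (mem_fiber.mpr rfl) h'

lemma mem_nonMergingBlocks_of_notMem_mergingEdges {y y' : Y} (h : (y, y') ∈ E)
    (hR : (y, y') ∉ mergingEdges E κ) : (κ y, κ y') ∈ nonMergingBlocks E κ := by
  refine mem_filter.mpr ⟨mem_lumpedEdges_of_mem h, fun heq => hR ?_⟩
  refine mem_filter.mpr ⟨h, ?_⟩
  change y ∈ mergingRows E κ (κ y) (κ y')
  exact heq ▸ mem_fiber.mpr rfl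

lemma mem_anchorEdges {a : Y → X → Y} {x x' : X} {y y' : Y} :
    (y, y') ∈ anchorEdges κ a x x' ↔ κ y = x ∧ y' = a y x' := by
  simp only [anchorEdges, mem_image, mem_fiber, Prod.mk.injEq]
  constructor
  · rintro ⟨z, hz, rfl, rfl⟩
    exact ⟨hz, rfl⟩
  · rintro ⟨hz, rfl⟩
    exact ⟨y, hz, rfl, rfl⟩

lemma mem_anchorEdges_block {a : Y → X → Y} (ha : IsAnchorChoice E κ a) {x x' : X}
    (hx : (x, x') ∈ lumpedEdges E κ) {y y' : Y} (h : (y, y') ∈ anchorEdges κ a x x') :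
    (x, x') = (κ y, κ y') := by
  obtain ⟨rfl, rfl⟩ := mem_anchorEdges.mp h
  rw [mem_fiber.mp (ha _ hx y (mem_fiber.mpr rfl)).2]

lemma sum_lumpableBasis_apply {a : Y → X → Y} (ha : IsAnchorChoice E κ a)
    (t : X × X → ℝ) (c : Y × Y → ℝ) {y y' : Y} (h : (y, y') ∈ E) :
    (∑ i, (Sum.elim (fun p : nonMergingBlocks E κ => t p) (fun e : mergingEdges E κ => c e)) i •
      lumpableBasis ℝ E κ a i) ⟨(y, y'), h⟩ =
      (if (κ y, κ y') ∈ nonMergingBlocks E κ ∧ y' = a y (κ y') then t (κ y, κ y') else 0) +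
        if (y, y') ∈ mergingEdges E κ then c (y, y') else 0 := by
  rw [Fintype.sum_sum_type, Pi.add_apply, Finset.sum_apply, Finset.sum_apply]
  simp only [Sum.elim_inl, Sum.elim_inr, lumpableBasis, Pi.smul_apply, smul_eq_mul, mul_ite,
    mul_one, mul_zero]
  congr 1
  · rw [sum_coe_sort (nonMergingBlocks E κ)
      (fun p => if (y, y') ∈ anchorEdges κ a p.1 p.2 then t p else 0)]
    have hp : ∀ p ∈ nonMergingBlocks E κ,
        (if (y, y') ∈ anchorEdges κ a p.1 p.2 then t p else 0) =
        if p = (κ y, κ y') then (if y' = a y (κ y') then t (κ y, κ y') else 0) else 0 := by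
      rintro ⟨x, x'⟩ hp
      by_cases hxx : (x, x') = (κ y, κ y')
      · obtain ⟨rfl, rfl⟩ := Prod.mk.inj hxx
        simp [mem_anchorEdges]
      · rw [if_neg hxx, if_neg]
        exact fun hm => hxx (mem_anchorEdges_block ha (mem_filter.mp hp).1 hm)
    rw [sum_congr rfl hp, sum_ite_eq', ite_and]
  · rw [sum_coe_sort (mergingEdges E κ) (fun e => if (y, y') = e then c e else 0), sum_ite_eq]

lemma linearIndependent_lumpableBasis {a : Y → X → Y} (ha : IsAnchorChoice E κ a) :
    LinearIndependent ℝ (lumpableBasis ℝ E κ a) := by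
  rw [Fintype.linearIndependent_iff]
  intro g hg
  let t : X × X → ℝ := fun p => if h : p ∈ nonMergingBlocks E κ then g (Sum.inl ⟨p, h⟩) else 0
  let c : Y × Y → ℝ := fun e => if h : e ∈ mergingEdges E κ then g (Sum.inr ⟨e, h⟩) else 0
  have hgt : g = Sum.elim (fun p : nonMergingBlocks E κ => t p)
      (fun e : mergingEdges E κ => c e) := by
    ext (⟨p, hp⟩ | ⟨e, he⟩)
    · simp [t]
    · simp [c]
  have key : ∀ y y', (y, y') ∈ E →
      (if (κ y, κ y') ∈ nonMergingBlocks E κ ∧ y' = a y (κ y') then t (κ y, κ y') else 0) +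
        (if (y, y') ∈ mergingEdges E κ then c (y, y') else 0) = 0 := by
    intro y y' h
    rw [← sum_lumpableBasis_apply ha t c h, ← hgt, hg]
    rfl
  -- The anchor edge of a non-merging row lies in no other member of the system.
  have ht : ∀ p ∈ nonMergingBlocks E κ, t p = 0 := by
    rintro ⟨x, x'⟩ hp
    obtain ⟨hD, hne⟩ := mem_filter.mp hp
    obtain ⟨y, hy, hyM⟩ : ∃ y ∈ fiber κ x, y ∉ mergingRows E κ x x' := by
      by_contra! hall
      exact hne (Subset.antisymm (filter_subset _ _) hall)
    obtain ⟨hE, hx'⟩ := ha _ hD y hy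
    simp only [mem_fiber] at hx' hy
    have h := key y (a y x') hE
    rw [hx', hy, if_pos ⟨hp, rfl⟩, if_neg, add_zero] at h
    · exact h
    · intro hR
      have := (mem_filter.mp hR).2
      simp only [hy, hx'] at this
      exact hyM this
  have hc : ∀ e ∈ mergingEdges E κ, c e = 0 := by
    rintro ⟨y, y'⟩ he
    have h := key y y' (mem_filter.mp he).1
    rw [if_pos he] at h
    split_ifs at h with h1
    · rw [ht _ h1.1, zero_add] at h
      exact h
    · rwa [zero_add] at h
  rw [hgt]
  rintro (⟨p, hp⟩ | ⟨e, he⟩)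
  · exact ht p hp
  · exact hc e he

/-- A function lies in the span as soon as on the edges outside merging rows it depends only on
the block. -/
lemma mem_span_lumpableBasis {a : Y → X → Y} (ha : IsAnchorChoice E κ a) {h : E → ℝ}
    (t : X × X → ℝ) (ht : ∀ y y' (he : (y, y') ∈ E), (y, y') ∉ mergingEdges E κ →
      h ⟨(y, y'), he⟩ = t (κ y, κ y')) :
    h ∈ Submodule.span ℝ (Set.range (lumpableBasis ℝ E κ a)) := by
  let c : Y × Y → ℝ := fun e => (if he : e ∈ E then h ⟨e, he⟩ else 0) -
    if (κ e.1, κ e.2) ∈ nonMergingBlocks E κ ∧ e.2 = a e.1 (κ e.2) then t (κ e.1, κ e.2) else 0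
  refine (Submodule.mem_span_range_iff_exists_fun ℝ).mpr
    ⟨Sum.elim (fun p : nonMergingBlocks E κ => t p) (fun e : mergingEdges E κ => c e), ?_⟩
  ext ⟨⟨y, y'⟩, he⟩
  rw [sum_lumpableBasis_apply ha t c he]
  by_cases hR : (y, y') ∈ mergingEdges E κ
  · rw [if_pos hR]
    simp only [c, dif_pos he]
    ring
  · obtain ⟨hEa, hκa⟩ := ha _ (mem_lumpedEdges_of_mem he) y (mem_fiber.mpr rfl)
    have hya : y' = a y (κ y') := by
      by_contra hne
      exact hR ((mem_mergingEdges_iff he).mpr ⟨_, hEa, mem_fiber.mp hκa, fun h' => hne h'.symm⟩)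
    rw [if_neg hR, if_pos ⟨mem_nonMergingBlocks_of_notMem_mergingEdges he hR, hya⟩, add_zero,
      ht y y' he hR]

lemma log_mem_span_lumpableBasis (hκ : Function.Surjective κ) {a : Y → X → Y}
    (ha : IsAnchorChoice E κ a) {F : E → ℝ} (hF : F ∈ positiveLumpable E κ) :
    (fun e => Real.log (F e)) ∈ Submodule.span ℝ (Set.range (lumpableBasis ℝ E κ a)) := by
  rw [mem_positiveLumpable_iff] at hF
  choose s hs using hκ
  refine mem_span_lumpableBasis ha (fun p => Real.log (blockSum E κ (s p.1) p.2 F))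
    fun y y' he hR => ?_
  rw [hF.2 _ y _ (hs _), blockSum_of_notMem_mergingEdges he hR]

lemma blockSum_single (e : E) (c : ℝ) (y : Y) (x' : X) :
    blockSum E κ y x' (Pi.single e c) = if y = e.1.1 ∧ κ e.1.2 = x' then c else 0 := by
  obtain ⟨⟨z, z'⟩, h⟩ := e
  have hm : ∀ y', edgeMatrix E (Pi.single (⟨(z, z'), h⟩ : E) c) y y' =
      if y' = z' then (if y = z then c else 0) else 0 := by
    intro y'
    unfold edgeMatrix
    split_ifs with h1 h2 h3 h4 h5
    · subst h2 h3
      simp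
    · exact Pi.single_eq_of_ne (fun h' => h3 (by simpa using congrArg (fun e : E => e.1.1) h')) _
    · exact Pi.single_eq_of_ne (fun h' => h2 (by simpa using congrArg (fun e : E => e.1.2) h')) _
    · subst h4 h5
      exact absurd h h1
    · rfl
    · rfl
  simp only [blockSum_apply, hm, sum_ite_eq', mem_fiber]
  by_cases h1 : y = z <;> by_cases h2 : κ z' = x' <;> simp [h1, h2]

/-- Redistributing the mass of two edges in the same row and block keeps a function in `ℱ_κ⁺`. -/
lemma redistribute_mem_positiveLumpable {F : E → ℝ} (hF : F ∈ positiveLumpable E κ) {e e' : E}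
    (hne : e ≠ e') (h1 : e.1.1 = e'.1.1) (h2 : κ e.1.2 = κ e'.1.2) {α β : ℝ} (hα : 0 < α)
    (hβ : 0 < β) (hsum : α + β = F e + F e') :
    Function.update (Function.update F e α) e' β ∈ positiveLumpable E κ := by
  rw [mem_positiveLumpable_iff] at hF ⊢
  have hdec : Function.update (Function.update F e α) e' β =
      F + (Pi.single e (α - F e) + Pi.single e' (β - F e')) := by
    ext f
    by_cases hf' : f = e'
    · subst hf'
      simp [Pi.single_eq_of_ne hne.symm]
    · by_cases hf : f = e
      · subst hf
        simp [Function.update_of_ne hf', Pi.single_eq_of_ne hf']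
      · simp [Function.update_of_ne hf', Function.update_of_ne hf, Pi.single_eq_of_ne hf',
          Pi.single_eq_of_ne hf]
  have hb : ∀ y x', blockSum E κ y x' (Function.update (Function.update F e α) e' β) =
      blockSum E κ y x' F := by
    intro y x'
    rw [hdec, map_add, map_add, blockSum_single, blockSum_single, h1, h2]
    split_ifs <;> linarith
  refine ⟨fun f => ?_, fun y₁ y₂ x' hy => by rw [hb, hb, hF.2 y₁ y₂ x' hy]⟩
  by_cases hf' : f = e'
  · subst hf'
    simpa using hβ
  · rw [Function.update_of_ne hf']
    by_cases hf : f = e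
    · subst hf
      simpa using hα
    · rw [Function.update_of_ne hf]
      exact hF.1 f

lemma scaleBlock_mem_positiveLumpable {F : E → ℝ} (hF : F ∈ positiveLumpable E κ) (p : X × X)
    {c : ℝ} (hc : 0 < c) :
    (fun e : E => F e * if (κ e.1.1, κ e.1.2) = p then c else 1) ∈ positiveLumpable E κ := by
  rw [mem_positiveLumpable_iff] at hF ⊢
  have hb : ∀ y x', blockSum E κ y x'
      (fun e : E => F e * if (κ e.1.1, κ e.1.2) = p then c else 1) =
      blockSum E κ y x' F * if (κ y, x') = p then c else 1 := fun y x' => by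
    rw [blockSum_apply, blockSum_apply, sum_mul]
    refine sum_congr rfl fun y' hy' => ?_
    rw [edgeMatrix_mul_apply F (fun q => if (κ q.1, κ q.2) = p then c else 1), mem_fiber.mp hy']
  refine ⟨fun e => mul_pos (hF.1 e) (by split_ifs <;> [exact hc; exact one_pos]),
    fun y₁ y₂ x' hy => ?_⟩
  rw [hb, hb, hF.2 y₁ y₂ x' hy, hy]

/-- Splitting the mass of two edges in the ratios `1 : 1`, `1 : 3` and `3 : 1` yields differences
of logarithms that isolate one of the two edges. -/
lemma single_mem_of_log_sub_mem {F₀ : E → ℝ} (hF₀ : F₀ ∈ positiveLumpable E κ)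
    {W : Submodule ℝ (E → ℝ)}
    (hW : ∀ F ∈ positiveLumpable E κ, ∀ G ∈ positiveLumpable E κ,
      (fun e => Real.log (F e) - Real.log (G e)) ∈ W)
    {e : E} (he : (e : Y × Y) ∈ mergingEdges E κ) : (Pi.single e 1 : E → ℝ) ∈ W := by
  obtain ⟨⟨y, y'⟩, hE⟩ := e
  obtain ⟨z, hz, hκz, hzy⟩ := (mem_mergingEdges_iff hE).mp he
  set e : E := ⟨(y, y'), hE⟩
  set e' : E := ⟨(y, z), hz⟩
  have hne : e ≠ e' := fun h => hzy (by simpa [e, e'] using (congrArg (fun f : E => f.1.2) h).symm)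
  have hpos := hF₀.1
  set s := F₀ e + F₀ e' with hs
  have hs0 : 0 < s := add_pos (hpos e) (hpos e')
  let G : ℝ → E → ℝ := fun τ => Function.update (Function.update F₀ e (τ * s)) e' ((1 - τ) * s)
  have hG : ∀ τ, 0 < τ → τ < 1 → G τ ∈ positiveLumpable E κ := fun τ h0 h1 =>
    redistribute_mem_positiveLumpable hF₀ hne rfl hκz.symm (mul_pos h0 hs0)
      (mul_pos (sub_pos.mpr h1) hs0) (by rw [← hs]; ring)
  have hlog : ∀ τ, 0 < τ → τ < 1 → (fun f => Real.log (G τ f) - Real.log (G (1 / 2) f)) =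
      Real.log (2 * τ) • (Pi.single e 1 : E → ℝ) +
        Real.log (2 * (1 - τ)) • (Pi.single e' 1 : E → ℝ) := by
    intro τ h0 h1
    ext f
    by_cases hf' : f = e'
    · subst hf'
      simp only [G, Function.update_self, Pi.add_apply, Pi.smul_apply, Pi.single_apply,
        if_neg hne.symm, if_true, mul_zero, zero_add, smul_eq_mul, mul_one]
      rw [← Real.log_div (mul_pos (sub_pos.mpr h1) hs0).ne' (by positivity)]
      congr 1
      field_simp
      norm_num
    · by_cases hf : f = e
      · subst hf
        simp only [G, Function.update_self, Function.update_of_ne hf', Pi.add_apply,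
          Pi.smul_apply, Pi.single_apply, if_neg hf', if_true, mul_zero, add_zero,
          smul_eq_mul, mul_one]
        rw [← Real.log_div (mul_pos h0 hs0).ne' (by positivity)]
        congr 1
        field_simp
      · simp [G, Function.update_of_ne hf', Function.update_of_ne hf, Pi.single_eq_of_ne hf',
          Pi.single_eq_of_ne hf]
  have h1 := hW _ (hG (1 / 4) (by norm_num) (by norm_num)) _ (hG (1 / 2) (by norm_num) (by norm_num))
  have h3 := hW _ (hG (3 / 4) (by norm_num) (by norm_num)) _ (hG (1 / 2) (by norm_num) (by norm_num))
  rw [hlog _ (by norm_num) (by norm_num)] at h1 h3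
  norm_num only at h1 h3
  set u := Real.log (3 / 2) with hu
  set w := Real.log (1 / 2) with hw
  have hu0 : 0 < u := Real.log_pos (by norm_num)
  have hw0 : w < 0 := Real.log_neg (by norm_num) (by norm_num)
  have huw : u + w < 0 := by
    rw [hu, hw, ← Real.log_mul (by norm_num) (by norm_num)]
    exact Real.log_neg (by norm_num) (by norm_num)
  have hdet : (u - w) * (u + w) ≠ 0 := mul_ne_zero (by linarith) huw.ne
  have h := W.smul_mem ((u - w) * (u + w))⁻¹ (W.sub_mem (W.smul_mem u h3) (W.smul_mem w h1))
  convert h using 1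
  ext f
  simp only [Pi.smul_apply, Pi.sub_apply, Pi.add_apply, smul_eq_mul]
  rw [eq_inv_mul_iff_mul_eq₀ hdet]
  ring

lemma lumpableBasis_mem_of_log_sub_mem {a : Y → X → Y} (ha : IsAnchorChoice E κ a)
    (hne : (positiveLumpable E κ).Nonempty) {W : Submodule ℝ (E → ℝ)}
    (hW : ∀ F ∈ positiveLumpable E κ, ∀ G ∈ positiveLumpable E κ,
      (fun e => Real.log (F e) - Real.log (G e)) ∈ W)
    (i : nonMergingBlocks E κ ⊕ mergingEdges E κ) : lumpableBasis ℝ E κ a i ∈ W := by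
  obtain ⟨F, hF⟩ := hne
  have hsingle := fun e => single_mem_of_log_sub_mem hF hW (e := e)
  rcases i with ⟨⟨x, x'⟩, hp⟩ | ⟨e₀, he₀⟩
  · have hD := (mem_filter.mp hp).1
    -- Scaling the block by `exp 1` isolates its indicator, which differs from that of the anchor
    -- edges only by edges in merging rows.
    have h1 := hW _ (scaleBlock_mem_positiveLumpable hF (x, x') (Real.exp_pos 1)) _ hF
    have h2 : ∑ e : E, (if (e : Y × Y) ∈ mergingEdges E κ ∧ (κ e.1.1, κ e.1.2) = (x, x') ∧
        (e : Y × Y) ∉ anchorEdges κ a x x' then (1 : ℝ) else 0) • (Pi.single e 1 : E → ℝ) ∈ W := by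
      refine W.sum_mem fun e _ => ?_
      split_ifs with h
      · exact W.smul_mem _ (hsingle e h.1)
      · rw [zero_smul]
        exact W.zero_mem
    convert W.sub_mem h1 h2 using 1
    ext ⟨⟨y, y'⟩, h⟩
    have hl : Real.log (F ⟨(y, y'), h⟩ * if (κ y, κ y') = (x, x') then Real.exp 1 else 1) -
        Real.log (F ⟨(y, y'), h⟩) = if (κ y, κ y') = (x, x') then 1 else 0 := by
      have hpos := hF.1 ⟨(y, y'), h⟩
      split_ifs
      · rw [Real.log_mul hpos.ne' (Real.exp_pos _).ne', Real.log_exp]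
        ring
      · rw [mul_one, sub_self]
    rw [Pi.sub_apply, hl]
    simp only [lumpableBasis, Finset.sum_apply, Pi.smul_apply, Pi.single_apply,
      smul_eq_mul, mul_ite, mul_one, mul_zero, sum_ite_eq, mem_univ, if_true]
    by_cases hA : (y, y') ∈ anchorEdges κ a x x'
    · have := (mem_anchorEdges_block ha hD hA).symm
      simp [hA, this]
    · by_cases hxx : (κ y, κ y') = (x, x')
      · obtain ⟨rfl, rfl⟩ := Prod.mk.inj hxx
        have hR : (y, y') ∈ mergingEdges E κ := by
          obtain ⟨hEa, hκa⟩ := ha _ hD y (mem_fiber.mpr rfl)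
          exact (mem_mergingEdges_iff h).mpr ⟨_, hEa, mem_fiber.mp hκa,
            fun h' => hA (mem_anchorEdges.mpr ⟨rfl, h'.symm⟩)⟩
        simp [hA, hR]
      · simp [hA, hxx]
  · convert hsingle ⟨e₀, (mem_filter.mp he₀).1⟩ he₀ using 1
    ext e
    simp [lumpableBasis, Pi.single_apply, Subtype.ext_iff]

lemma span_lumpableBasis (hκ : Function.Surjective κ) {a : Y → X → Y} (ha : IsAnchorChoice E κ a)
    (hne : (positiveLumpable E κ).Nonempty) :
    Submodule.span ℝ (Set.range (lumpableBasis ℝ E κ a)) =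
      Submodule.span ℝ (logLumpable E κ) := by
  refine le_antisymm (Submodule.span_le.mpr ?_) (Submodule.span_le.mpr ?_)
  · rintro _ ⟨i, rfl⟩
    refine lumpableBasis_mem_of_log_sub_mem ha hne (fun F hF G hG => ?_) i
    exact Submodule.sub_mem _ (Submodule.subset_span ⟨F, hF, rfl⟩)
      (Submodule.subset_span ⟨G, hG, rfl⟩)
  · rintro _ ⟨F, hF, rfl⟩
    exact log_mem_span_lumpableBasis hκ ha hF

lemma exists_isAnchorChoice [Nonempty Y] (hne : (positiveLumpable E κ).Nonempty) :
    ∃ a : Y → X → Y, IsAnchorChoice E κ a := by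
  obtain ⟨F, hF⟩ := hne
  have h : ∀ y x', ∃ y', (κ y, x') ∈ lumpedEdges E κ → (y, y') ∈ E ∧ κ y' = x' := fun y x' => by
    by_cases hp : (κ y, x') ∈ lumpedEdges E κ
    · obtain ⟨y', hy'⟩ := exists_edge_of_mem_lumpedEdges hF hp
      exact ⟨y', fun _ => hy'⟩
    · exact ⟨y, fun h' => absurd h' hp⟩
  choose a ha using h
  refine ⟨a, ?_⟩
  rintro ⟨x, x'⟩ hp y hy
  obtain rfl := mem_fiber.mp hy
  exact ⟨(ha y x' hp).1, mem_fiber.mpr (ha y x' hp).2⟩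

/-- The differences of elements of `𝒢_κ` span the same subspace as `𝒢_κ` itself; that is, the
affine hull of `𝒢_κ` contains `0`. -/
lemma span_logLumpable_le [Nonempty Y] (hκ : Function.Surjective κ)
    (hne : (positiveLumpable E κ).Nonempty) {W : Submodule ℝ (E → ℝ)}
    (hW : ∀ F ∈ positiveLumpable E κ, ∀ G ∈ positiveLumpable E κ,
      (fun e => Real.log (F e) - Real.log (G e)) ∈ W) :
    Submodule.span ℝ (logLumpable E κ) ≤ W := by
  obtain ⟨a, ha⟩ := exists_isAnchorChoice hne
  rw [← span_lumpableBasis hκ ha hne, Submodule.span_le]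
  rintro _ ⟨i, rfl⟩
  exact lumpableBasis_mem_of_log_sub_mem ha hne hW i

end LumpableBasis

/-! ### The basis of `𝒩(Y, E)` -/

section AntiShiftBasis

variable {Y : Type*} [Fintype Y] [DecidableEq Y] {E : Finset (Y × Y)}

lemma sum_antiShiftBasis_apply (yStar : Y) (g : Option {y : Y // y ≠ yStar} → ℝ) (e : E) :
    (∑ i, g i • antiShiftBasis ℝ E yStar i) e =
      (if h : e.1.2 ≠ yStar then g (some ⟨e.1.2, h⟩) else 0) -
        (if h : e.1.1 ≠ yStar then g (some ⟨e.1.1, h⟩) else 0) + g none := by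
  have hsum : ∀ z : Y, ∑ y : {y : Y // y ≠ yStar}, (if z = y.1 then g (some y) else 0) =
      if h : z ≠ yStar then g (some ⟨z, h⟩) else 0 := by
    intro z
    split_ifs with h
    · rw [sum_eq_single ⟨z, h⟩]
      · simp
      · exact fun b _ hb => if_neg fun h' => hb (Subtype.ext h'.symm)
      · exact fun h' => absurd (mem_univ _) h'
    · exact sum_eq_zero fun b _ => if_neg (by rintro rfl; exact h b.2)
  rw [Fintype.sum_option, Pi.add_apply, Finset.sum_apply]
  simp only [antiShiftBasis, Pi.smul_apply, smul_eq_mul, mul_one, mul_sub, mul_ite, mul_zero,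
    sum_sub_distrib, hsum]
  ring

lemma linearIndependent_antiShiftBasis [Nonempty Y] (hE : StronglyConnected E)
    (hne : (stochasticFamily E).Nonempty) (yStar : Y) :
    LinearIndependent ℝ (antiShiftBasis ℝ E yStar) := by
  rw [Fintype.linearIndependent_iff]
  intro g hg
  obtain ⟨hc, hf⟩ := const_of_antiShift_eq_zero hE hne
    (f := fun y => if h : y ≠ yStar then g (some ⟨y, h⟩) else 0) (c := g none) fun e => by
      rw [← sum_antiShiftBasis_apply yStar g e, hg]
      rfl
  rintro (_ | ⟨y, hy⟩)
  · exact hc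
  · simpa [hy] using hf y yStar

lemma span_antiShiftBasis (yStar : Y) :
    Submodule.span ℝ (Set.range (antiShiftBasis ℝ E yStar)) = antiShift E := by
  refine le_antisymm (Submodule.span_le.mpr ?_) ?_
  · rintro _ ⟨_ | y₀, rfl⟩
    · exact ⟨1, 0, fun e => by simp [antiShiftBasis]⟩
    · exact ⟨0, fun y => if y = y₀.1 then 1 else 0, fun e => by simp [antiShiftBasis]⟩
  · rintro N ⟨c, f, h⟩
    refine (Submodule.mem_span_range_iff_exists_fun ℝ).mpr
      ⟨fun i => i.elim c fun y => f y.1 - f yStar, ?_⟩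
    ext e
    have hz : ∀ z, (if h : z ≠ yStar then f z - f yStar else 0) = f z - f yStar := fun z => by
      by_cases hz : z = yStar <;> simp [hz]
    rw [sum_antiShiftBasis_apply, h]
    simp only [Option.elim_some, Option.elim_none, hz]
    ring

lemma finrank_antiShift [Nonempty Y] (hE : StronglyConnected E)
    (hne : (stochasticFamily E).Nonempty) : Module.finrank ℝ (antiShift E) = Fintype.card Y := by
  obtain ⟨y⟩ := ‹Nonempty Y›
  have : Nonempty Y := ⟨y⟩
  rw [← span_antiShiftBasis y, finrank_span_eq_card (linearIndependent_antiShiftBasis hE hne y),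
    Fintype.card_option, Fintype.card_subtype_compl, Fintype.card_subtype_eq]
  exact Nat.sub_add_cancel Fintype.card_pos

end AntiShiftBasis

/-! ### The dimension of `𝒲_κ` -/

section BlockRow

variable {X Y : Type*} [Fintype Y] [DecidableEq X]

/-- The pairs of a vertex `y` and a lumped state `x'` such that `y` has edges into `S_{x'}`. -/
abbrev BlockRow {X Y : Type*} [DecidableEq X] (E : Finset (Y × Y)) (κ : Y → X) : Type _ :=
  {r : Y × X // (κ r.1, r.2) ∈ lumpedEdges E κ}

lemma card_blockRow [Fintype X] {E : Finset (Y × Y)} {κ : Y → X} :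
    Fintype.card (BlockRow E κ) = ∑ p ∈ lumpedEdges E κ, (fiber κ p.1).card := by
  have hmaps : ∀ r ∈ univ.filter fun r : Y × X => (κ r.1, r.2) ∈ lumpedEdges E κ,
      (κ r.1, r.2) ∈ lumpedEdges E κ := fun r hr => (mem_filter.mp hr).2
  rw [Fintype.card_subtype, card_eq_sum_card_fiberwise hmaps]
  refine sum_congr rfl fun p hp => ?_
  symm
  refine card_bij (fun y _ => (y, p.2)) (fun y hy => ?_) (fun y _ y' _ h => (Prod.mk.inj h).1)
    (fun r hr => ?_)
  · simpa [mem_fiber.mp hy] using hp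
  · have h := (mem_filter.mp hr).2
    exact ⟨r.1, mem_fiber.mpr (congrArg Prod.fst h), Prod.ext rfl (congrArg Prod.snd h).symm⟩

end BlockRow

section Tangent

variable {X Y : Type*} [Fintype Y] [DecidableEq X] [DecidableEq Y] {E : Finset (Y × Y)} {κ : Y → X}

/-- The sum of a row, written as a block sum for the map to a point. -/
noncomputable def rowSum (E : Finset (Y × Y)) (y : Y) : (E → ℝ) →ₗ[ℝ] ℝ :=
  blockSum E (fun _ => ()) y ()

lemma rowSum_apply (F : E → ℝ) (y : Y) : rowSum E y F = ∑ y', edgeMatrix E F y y' := by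
  simp [rowSum, blockSum_apply, fiber]

/-- The directions tangent to `𝒲_κ`: the functions with zero row sums whose block sums depend
only on the block. -/
noncomputable def tangentSpace (E : Finset (Y × Y)) (κ : Y → X) : Submodule ℝ (E → ℝ) where
  carrier := {τ | (∀ y, rowSum E y τ = 0) ∧
    ∀ y₁ y₂ x', κ y₁ = κ y₂ → blockSum E κ y₁ x' τ = blockSum E κ y₂ x' τ}
  zero_mem' := by simp
  add_mem' := fun {τ τ'} h h' => ⟨fun y => by rw [map_add, h.1, h'.1, add_zero],
    fun y₁ y₂ x' hy => by rw [map_add, map_add, h.2 _ _ _ hy, h'.2 _ _ _ hy]⟩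
  smul_mem' := fun c τ h => ⟨fun y => by rw [map_smul, h.1, smul_zero],
    fun y₁ y₂ x' hy => by rw [map_smul, map_smul, h.2 _ _ _ hy]⟩

lemma mem_tangentSpace {τ : E → ℝ} : τ ∈ tangentSpace E κ ↔ (∀ y, rowSum E y τ = 0) ∧
    ∀ y₁ y₂ x', κ y₁ = κ y₂ → blockSum E κ y₁ x' τ = blockSum E κ y₂ x' τ := Iff.rfl

lemma mem_stochasticFamily_iff {P : E → ℝ} :
    P ∈ stochasticFamily E ↔ (∀ e, 0 < P e) ∧ ∀ y, rowSum E y P = 1 := by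
  refine and_congr_right fun hP => ?_
  rw [Matrix.mem_rowStochastic_iff_sum]
  simp only [rowSum_apply]
  exact and_iff_right (edgeMatrix_nonneg hP)

lemma mem_lumpableFamily_iff_sums [Fintype X] (hκ : Function.Surjective κ) {P : E → ℝ} :
    P ∈ lumpableFamily E κ ↔ (∀ e, 0 < P e) ∧ (∀ y, rowSum E y P = 1) ∧
      ∀ y₁ y₂ x', κ y₁ = κ y₂ → blockSum E κ y₁ x' P = blockSum E κ y₂ x' P := by
  rw [mem_lumpableFamily_iff hκ, mem_stochasticFamily_iff, mem_positiveLumpable_iff]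
  tauto

lemma add_mem_lumpableFamily [Fintype X] (hκ : Function.Surjective κ) {P τ : E → ℝ}
    (hP : P ∈ lumpableFamily E κ) (hτ : τ ∈ tangentSpace E κ) (hpos : ∀ e, 0 < P e + τ e) :
    P + τ ∈ lumpableFamily E κ := by
  rw [mem_lumpableFamily_iff_sums hκ] at hP ⊢
  rw [mem_tangentSpace] at hτ
  refine ⟨hpos, fun y => ?_, fun y₁ y₂ x' hy => ?_⟩
  · rw [map_add, hP.2.1, hτ.1, add_zero]
  · rw [map_add, map_add, hP.2.2 _ _ _ hy, hτ.2 _ _ _ hy]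

lemma sub_mem_tangentSpace [Fintype X] (hκ : Function.Surjective κ) {P P' : E → ℝ}
    (hP : P ∈ lumpableFamily E κ) (hP' : P' ∈ lumpableFamily E κ) :
    P' - P ∈ tangentSpace E κ := by
  rw [mem_lumpableFamily_iff_sums hκ] at hP hP'
  refine mem_tangentSpace.mpr ⟨fun y => ?_, fun y₁ y₂ x' hy => ?_⟩
  · rw [map_sub, hP.2.1, hP'.2.1, sub_self]
  · rw [map_sub, map_sub, hP.2.2 _ _ _ hy, hP'.2.2 _ _ _ hy]

/-- The linear equations on pairs `(τ, q)` of functions on `E` and `D` saying that `q` is the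
lumped image of `τ` and has zero row sums. -/
noncomputable def lumpingEquations [Fintype X] (E : Finset (Y × Y)) (κ : Y → X) :
    ((E → ℝ) × (lumpedEdges E κ → ℝ)) →ₗ[ℝ] (BlockRow E κ → ℝ) × (X → ℝ) :=
  LinearMap.prod
    (LinearMap.pi fun r => blockSum E κ r.1.1 r.1.2 ∘ₗ LinearMap.fst _ _ _ -
      LinearMap.proj (R := ℝ) (φ := fun _ : lumpedEdges E κ => ℝ) ⟨(κ r.1.1, r.1.2), r.2⟩ ∘ₗ
        LinearMap.snd _ _ _)
    (LinearMap.pi fun x => rowSum (lumpedEdges E κ) x ∘ₗ LinearMap.snd _ _ _)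

lemma lumpingEquations_surjective [Fintype X] [Nonempty Y] (hκ : Function.Surjective κ)
    (hne : (lumpableFamily E κ).Nonempty) :
    Function.Surjective (lumpingEquations E κ) := by
  obtain ⟨P, hP⟩ := hne
  rw [mem_lumpableFamily_iff hκ] at hP
  obtain ⟨a, ha⟩ := exists_isAnchorChoice ⟨P, hP.2⟩
  have hout : ∀ x, ∃ x', (x, x') ∈ lumpedEdges E κ := fun x => by
    obtain ⟨y, rfl⟩ := hκ x
    obtain ⟨y', -, hy'⟩ := exists_lt_of_sum_lt (s := univ) (f := fun _ => (0 : ℝ))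
      (g := edgeMatrix E P y) (by simp [sum_edgeMatrix_eq_one hP.1])
    exact ⟨κ y', mem_lumpedEdges_of_mem ((edgeMatrix_pos_iff hP.1.1).mp hy')⟩
  choose s hs using hout
  rintro ⟨α, β⟩
  let q : lumpedEdges E κ → ℝ := fun p => if p.1.2 = s p.1.1 then β p.1.1 else 0
  let γ : Y → X → ℝ := fun y x' => if h : (κ y, x') ∈ lumpedEdges E κ then
    α ⟨(y, x'), h⟩ + q ⟨(κ y, x'), h⟩ else 0
  let τ : E → ℝ := fun e => if e.1.2 = a e.1.1 (κ e.1.2) then γ e.1.1 (κ e.1.2) else 0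
  refine ⟨(τ, q), Prod.ext ?_ ?_⟩
  · ext ⟨⟨y, x'⟩, h⟩
    obtain ⟨hEa, hκa⟩ := ha _ h y (mem_fiber.mpr rfl)
    have hblock : blockSum E κ y x' τ = γ y x' := by
      rw [blockSum_apply, sum_eq_single_of_mem _ hκa, edgeMatrix_of_mem hEa]
      · simp only [τ]
        simp only [mem_fiber] at hκa
        rw [hκa, if_pos rfl]
      · intro y' hy' hne
        unfold edgeMatrix
        split_ifs with he
        · simp only [τ]
          rw [mem_fiber.mp hy', if_neg hne]
        · rfl
    change blockSum E κ y x' τ - q ⟨(κ y, x'), h⟩ = α ⟨(y, x'), h⟩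
    rw [hblock]
    simp only [γ, dif_pos h]
    ring
  · ext x
    change rowSum (lumpedEdges E κ) x q = β x
    rw [rowSum_apply, sum_eq_single (s x), edgeMatrix_of_mem (hs x)]
    · simp [q]
    · intro x' _ hne
      unfold edgeMatrix
      split_ifs <;> simp [q, hne]
    · exact fun h => absurd (mem_univ _) h

lemma mem_ker_lumpingEquations [Fintype X] {τ : E → ℝ} {q : lumpedEdges E κ → ℝ} :
    (τ, q) ∈ LinearMap.ker (lumpingEquations E κ) ↔
      (∀ y x' (h : (κ y, x') ∈ lumpedEdges E κ), blockSum E κ y x' τ = q ⟨(κ y, x'), h⟩) ∧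
        ∀ x, rowSum (lumpedEdges E κ) x q = 0 := by
  rw [LinearMap.mem_ker, Prod.ext_iff, funext_iff, funext_iff]
  refine and_congr ⟨fun h y x' hp => sub_eq_zero.mp (h ⟨(y, x'), hp⟩), fun h r => ?_⟩ Iff.rfl
  exact sub_eq_zero.mpr (h _ _ r.2)

lemma finrank_ker_lumpingEquations [Fintype X] (hκ : Function.Surjective κ) :
    Module.finrank ℝ (LinearMap.ker (lumpingEquations E κ)) =
      Module.finrank ℝ (tangentSpace E κ) := by
  let φ := LinearMap.fst ℝ (E → ℝ) (lumpedEdges E κ → ℝ) ∘ₗ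
    (LinearMap.ker (lumpingEquations E κ)).subtype
  have hinj : Function.Injective φ := by
    rw [← LinearMap.ker_eq_bot, LinearMap.ker_eq_bot']
    rintro ⟨⟨τ, q⟩, h⟩ (rfl : τ = 0)
    have hq : q = 0 := by
      ext ⟨⟨x, x'⟩, hp⟩
      obtain ⟨y, rfl⟩ := hκ x
      rw [← (mem_ker_lumpingEquations.mp h).1 y x' hp, map_zero]
      rfl
    subst hq
    rfl
  have hrow : ∀ (τ : E → ℝ) (q : lumpedEdges E κ → ℝ),
      (∀ y x' (h : (κ y, x') ∈ lumpedEdges E κ), blockSum E κ y x' τ = q ⟨(κ y, x'), h⟩) →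
      ∀ y, rowSum (lumpedEdges E κ) (κ y) q = rowSum E y τ := by
    intro τ q h y
    rw [rowSum_apply, rowSum_apply, ← sum_blockSum (κ := κ)]
    refine sum_congr rfl fun x' _ => ?_
    by_cases hp : (κ y, x') ∈ lumpedEdges E κ
    · rw [edgeMatrix_of_mem hp, h y x' hp]
    · rw [edgeMatrix_of_notMem hp, blockSum_of_notMem τ hp]
  have hrange : LinearMap.range φ = tangentSpace E κ := by
    ext τ
    constructor
    · rintro ⟨⟨⟨τ, q⟩, h⟩, rfl⟩
      obtain ⟨h1, h2⟩ := mem_ker_lumpingEquations.mp h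
      refine mem_tangentSpace.mpr ⟨fun y => ?_, fun y₁ y₂ x' hy => ?_⟩
      · exact (hrow τ q h1 y).symm.trans (h2 _)
      · change blockSum E κ y₁ x' τ = blockSum E κ y₂ x' τ
        by_cases hp : (κ y₁, x') ∈ lumpedEdges E κ
        · rw [h1 y₁ x' hp, h1 y₂ x' (hy ▸ hp)]
          congr 2
          rw [hy]
        · rw [blockSum_of_notMem τ hp, blockSum_of_notMem τ (hy ▸ hp)]
    · intro hτ
      rw [mem_tangentSpace] at hτ
      choose s hs using id hκ
      let q : lumpedEdges E κ → ℝ := fun p => blockSum E κ (s p.1.1) p.1.2 τ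
      have h1 : ∀ y x' (h : (κ y, x') ∈ lumpedEdges E κ),
          blockSum E κ y x' τ = q ⟨(κ y, x'), h⟩ := fun y x' _ => hτ.2 _ _ _ (hs _).symm
      refine ⟨⟨(τ, q), mem_ker_lumpingEquations.mpr ⟨h1, fun x => ?_⟩⟩, rfl⟩
      obtain ⟨y, rfl⟩ := hκ x
      rw [hrow τ q h1, hτ.1]
  rw [← hrange, LinearMap.finrank_range_of_inj hinj]

lemma finrank_tangentSpace [Fintype X] [Nonempty Y] (hκ : Function.Surjective κ)
    (hne : (lumpableFamily E κ).Nonempty) :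
    Module.finrank ℝ (tangentSpace E κ) + ∑ p ∈ lumpedEdges E κ, (fiber κ p.1).card +
      Fintype.card X = E.card + (lumpedEdges E κ).card := by
  have h := LinearMap.finrank_range_add_finrank_ker (lumpingEquations E κ)
  rw [LinearMap.range_eq_top.mpr (lumpingEquations_surjective hκ hne), finrank_top,
    finrank_ker_lumpingEquations hκ, Module.finrank_prod, Module.finrank_prod,
    Module.finrank_fintype_fun_eq_card, Module.finrank_fintype_fun_eq_card,
    Module.finrank_fintype_fun_eq_card, Module.finrank_fintype_fun_eq_card, card_blockRow,
    Fintype.card_coe, Fintype.card_coe] at h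
  omega

/-! ### The logarithmic chart -/

/-- The sum `log(P + τ) + n`, which parametrizes `log 𝒲_κ + 𝒩` near `log P`. -/
noncomputable def logChart (κ : Y → X) (P : E → ℝ) (x : tangentSpace E κ × antiShift E) : E → ℝ :=
  fun e => Real.log (P e + x.1.1 e) + x.2.1 e

/-- The differential `(τ, n) ↦ τ / P + n` of `logChart` at `τ = 0`. -/
noncomputable def logChartDeriv (κ : Y → X) (P : E → ℝ) :
    tangentSpace E κ × antiShift E →ₗ[ℝ] E → ℝ where
  toFun x := fun e => x.1.1 e / P e + x.2.1 e
  map_add' x x' := by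
    ext e
    simp only [Prod.fst_add, Prod.snd_add, Submodule.coe_add, Pi.add_apply, add_div]
    ring
  map_smul' c x := by
    ext e
    simp only [Prod.smul_fst, Prod.smul_snd, Submodule.coe_smul, Pi.smul_apply, smul_eq_mul,
      RingHom.id_apply, mul_add, mul_div_assoc]

/-- Injectivity holds because `τ / P` and `𝒩` are transversal: if `P · (f(y') - f(y) + c)` has
zero row sums, then the maximum principle makes `f` constant. -/
lemma logChartDeriv_injective [Nonempty Y] (hE : StronglyConnected E) {P : E → ℝ}
    (hP : P ∈ stochasticFamily E) : Function.Injective (logChartDeriv κ P) := by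
  rw [← LinearMap.ker_eq_bot, LinearMap.ker_eq_bot']
  rintro ⟨⟨τ, hτ⟩, ⟨n, hn⟩⟩ h
  obtain ⟨c, f, hf⟩ := id hn
  have hτn : ∀ e : E, τ e = P e * -(f e.1.2 - f e.1.1 + c) := fun e => by
    have h1 : τ e / P e + n e = 0 := congrFun h e
    have := (hP.1 e).ne'
    rw [hf] at h1
    field_simp at h1
    linarith
  have hrow := (mem_tangentSpace.mp hτ).1
  obtain ⟨hc, hconst⟩ := const_of_average_eq_add hE hP (f := f) (c := -c) fun y => by
    have h1 := hrow y
    rw [rowSum_apply, show τ = fun e : E => P e * -(f e.1.2 - f e.1.1 + c) from funext hτn,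
      sum_congr rfl fun y' _ => edgeMatrix_mul_apply P (fun r => -(f r.2 - f r.1 + c)) y y'] at h1
    have h2 : ∑ y', edgeMatrix E P y y' * -(f y' - f y + c) =
        (f y - c) * ∑ y', edgeMatrix E P y y' - ∑ y', edgeMatrix E P y y' * f y' := by
      rw [mul_sum, ← sum_sub_distrib]
      exact sum_congr rfl fun _ _ => by ring
    simp only at h1
    rw [h2, sum_edgeMatrix_eq_one hP] at h1
    linarith
  have hn0 : n = 0 := by
    ext e
    rw [hf, hconst e.1.2 e.1.1]
    simp only [Pi.zero_apply]
    linarith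
  have hτ0 : τ = 0 := by
    ext e
    rw [hτn, hconst e.1.2 e.1.1, sub_self, zero_add, hc, mul_zero]
    rfl
  subst hn0 hτ0
  rfl

lemma range_logChartDeriv_le [Fintype X] [Nonempty Y] (hκ : Function.Surjective κ) {P : E → ℝ}
    (hP : P ∈ lumpableFamily E κ) :
    LinearMap.range (logChartDeriv κ P) ≤
      Submodule.span ℝ (logLumpable E κ) ⊔ antiShift E := by
  rw [mem_lumpableFamily_iff hκ] at hP
  obtain ⟨a, ha⟩ := exists_isAnchorChoice ⟨P, hP.2⟩
  rintro _ ⟨⟨⟨τ, hτ⟩, n⟩, rfl⟩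
  refine Submodule.add_mem_sup (T := antiShift E) ?_ n.2
  rw [← span_lumpableBasis hκ ha ⟨P, hP.2⟩]
  choose s hs using hκ
  rw [mem_tangentSpace] at hτ
  have hP2 := mem_positiveLumpable_iff.mp hP.2
  refine mem_span_lumpableBasis ha
    (fun p => blockSum E κ (s p.1) p.2 τ / blockSum E κ (s p.1) p.2 P) fun y y' he hR => ?_
  simp only
  rw [hτ.2 _ y _ (hs _), hP2.2 _ y _ (hs _), blockSum_of_notMem_mergingEdges he hR,
    blockSum_of_notMem_mergingEdges he hR]

end Tangent

/-! ### Filling the span by dimension count -/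

section Saturation

variable {X Y : Type*} [Fintype Y] [DecidableEq X] [DecidableEq Y] {E : Finset (Y × Y)} {κ : Y → X}

lemma hasStrictFDerivAt_logChart {P : E → ℝ} (hP : ∀ e, 0 < P e) (n : antiShift E) :
    HasStrictFDerivAt (logChart κ P) (logChartDeriv κ P).toContinuousLinearMap (0, n) := by
  rw [hasStrictFDerivAt_pi']
  intro e
  let ℓ₁ : (tangentSpace E κ × antiShift E) →L[ℝ] ℝ := ContinuousLinearMap.proj e ∘L
    (tangentSpace E κ).subtypeL ∘L ContinuousLinearMap.fst ℝ _ _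
  let ℓ₂ : (tangentSpace E κ × antiShift E) →L[ℝ] ℝ := ContinuousLinearMap.proj e ∘L
    (antiShift E).subtypeL ∘L ContinuousLinearMap.snd ℝ _ _
  have hz : P e + ℓ₁ (0, n) = P e := by simp [ℓ₁]
  have h := ((ℓ₁.hasStrictFDerivAt.const_add (P e)).log (by rw [hz]; exact (hP e).ne')).add
    (ℓ₂.hasStrictFDerivAt (x := (0, n)))
  refine h.congr_fderiv ?_
  ext x
  · simp [ℓ₁, ℓ₂, logChartDeriv, div_eq_inv_mul]
  · simp [ℓ₁, ℓ₂, logChartDeriv]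

lemma contDiffOn_logChart (P : E → ℝ) :
    ContDiffOn ℝ 1 (logChart κ P) {x | ∀ e, 0 < P e + x.1.1 e} := by
  rw [contDiffOn_pi]
  intro e
  let ℓ₁ : (tangentSpace E κ × antiShift E) →L[ℝ] ℝ := ContinuousLinearMap.proj e ∘L
    (tangentSpace E κ).subtypeL ∘L ContinuousLinearMap.fst ℝ _ _
  let ℓ₂ : (tangentSpace E κ × antiShift E) →L[ℝ] ℝ := ContinuousLinearMap.proj e ∘L
    (antiShift E).subtypeL ∘L ContinuousLinearMap.snd ℝ _ _
  exact ((contDiff_const.add ℓ₁.contDiff).contDiffOn.log fun x hx => (hx e).ne').add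
    ℓ₂.contDiff.contDiffOn

lemma isOpen_logChart_domain (P : E → ℝ) :
    IsOpen {x : tangentSpace E κ × antiShift E | ∀ e, 0 < P e + x.1.1 e} := by
  simp only [Set.ofPred_forall]
  exact isOpen_iInter_of_finite fun e => isOpen_lt continuous_const
    (continuous_const.add ((continuous_apply e).comp (continuous_subtype_val.comp continuous_fst)))

lemma convex_logChart_domain (P : E → ℝ) :
    Convex ℝ {x : tangentSpace E κ × antiShift E | ∀ e, 0 < P e + x.1.1 e} := by
  intro x hx x' hx' a b ha hb hab e
  have h := hx e
  have h' := hx' e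
  have heq : P e + (a • x + b • x').1.1 e = a * (P e + x.1.1 e) + b * (P e + x'.1.1 e) := by
    simp only [Prod.fst_add, Prod.smul_fst, Submodule.coe_add, Submodule.coe_smul, Pi.add_apply,
      Pi.smul_apply, smul_eq_mul]
    linear_combination (-P e) * hab
  rw [heq]
  rcases ha.eq_or_lt with rfl | ha'
  · rw [zero_mul, zero_add]
    exact mul_pos (by linarith) h'
  · exact add_pos_of_pos_of_nonneg (mul_pos ha' h) (mul_nonneg hb h'.le)

variable [Fintype X]

lemma logChart_mem_logSaturation (hκ : Function.Surjective κ) {P : E → ℝ}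
    (hP : P ∈ lumpableFamily E κ) {x : tangentSpace E κ × antiShift E}
    (hx : ∀ e, 0 < P e + x.1.1 e) : logChart κ P x ∈ logSaturation E (lumpableFamily E κ) := by
  refine ⟨P + x.1, add_mem_lumpableFamily hκ hP x.1.2 hx, ?_⟩
  convert x.2.2 using 1
  ext e
  simp [logChart]

lemma exists_logChart_eq (hκ : Function.Surjective κ) {P : E → ℝ} (hP : P ∈ lumpableFamily E κ)
    {w : E → ℝ} (hw : w ∈ logSaturation E (lumpableFamily E κ)) :
    ∃ x : tangentSpace E κ × antiShift E, (∀ e, 0 < P e + x.1.1 e) ∧ logChart κ P x = w := by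
  obtain ⟨P', hP', hn⟩ := hw
  refine ⟨(⟨P' - P, sub_mem_tangentSpace hκ hP hP'⟩, ⟨_, hn⟩), fun e => ?_, ?_⟩
  · simpa using hP'.1.1 e
  · ext e
    simp [logChart]

/-- The linear subspace `span 𝒢_κ + 𝒩`. -/
abbrev logSpan (E : Finset (Y × Y)) (κ : Y → X) : Submodule ℝ (E → ℝ) :=
  Submodule.span ℝ (logLumpable E κ) ⊔ antiShift E

lemma logSaturation_subset_logSpan (hκ : Function.Surjective κ) {w : E → ℝ}
    (hw : w ∈ logSaturation E (lumpableFamily E κ)) : w ∈ logSpan E κ := by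
  obtain ⟨P, hP, hn⟩ := hw
  rw [← add_sub_cancel (fun e => Real.log (P e)) w]
  exact Submodule.add_mem_sup
    (Submodule.subset_span ⟨P, ((mem_lumpableFamily_iff hκ).mp hP).2, rfl⟩) hn

/-- `𝒲_κ` is an e-family if and only if `log 𝒲_κ + 𝒩` fills `span 𝒢_κ + 𝒩`. -/
lemma isEFamily_lumpableFamily_iff [Nonempty Y] (hE : StronglyConnected E)
    (hκ : Function.Surjective κ) (hne : (lumpableFamily E κ).Nonempty) :
    IsEFamily E (lumpableFamily E κ) ↔
      ∀ w ∈ logSpan E κ, w ∈ logSaturation E (lumpableFamily E κ) := by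
  obtain ⟨P, hP⟩ := hne
  have hPl := ((mem_lumpableFamily_iff hκ).mp hP).2
  have hEne := nonempty_of_mem_stochasticFamily hP.1
  rw [isEFamily_iff hE fun P hP => hP.1]
  constructor
  · rintro ⟨K, D, hD, hmem⟩ w hw
    have hlog : ∀ F ∈ positiveLumpable E κ, (fun e => Real.log (F e)) - K ∈ D := fun F hF =>
      (hmem _).mp (log_mem_logSaturation hE hκ hEne hF)
    have hspan : Submodule.span ℝ (logLumpable E κ) ≤ D :=
      span_logLumpable_le hκ ⟨P, hPl⟩ fun F hF G hG => by
        have := D.sub_mem (hlog F hF) (hlog G hG)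
        rwa [sub_sub_sub_cancel_right] at this
    have hK : K ∈ D := by
      have := D.sub_mem (hspan (Submodule.subset_span ⟨P, hPl, rfl⟩)) (hlog P hPl)
      rwa [sub_sub_cancel] at this
    exact (hmem w).mpr (D.sub_mem (sup_le hspan hD hw) hK)
  · intro h
    refine ⟨0, logSpan E κ, le_sup_right, fun w => ?_⟩
    rw [sub_zero]
    exact ⟨logSaturation_subset_logSpan hκ, h w⟩

/-- `log 𝒲_κ + 𝒩` is closed: it consists of the `w` for which `exp w` has a normalized
Perron-Frobenius eigenvector satisfying finitely many polynomial equations, and these eigenvectors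
range over a compact simplex. -/
lemma isClosed_logSaturation [Nonempty Y] (hE : StronglyConnected E) (hκ : Function.Surjective κ)
    (hEne : E.Nonempty) : IsClosed (logSaturation E (lumpableFamily E κ)) := by
  have : CompactSpace (stdSimplex ℝ Y) := isCompact_iff_compactSpace.mp (isCompact_stdSimplex ℝ Y)
  let M : (E → ℝ) → Matrix Y Y ℝ := fun w => edgeMatrix E fun e => Real.exp (w e)
  have hM0 : ∀ w y y', 0 ≤ M w y y' := fun w => edgeMatrix_nonneg fun e => Real.exp_pos _
  have hMpos : ∀ w y y', 0 < M w y y' ↔ (y, y') ∈ E := fun w y y' =>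
    edgeMatrix_pos_iff fun e => Real.exp_pos _
  have hMc : ∀ y y', Continuous fun w => M w y y' := by
    intro y y'
    simp only [M, edgeMatrix]
    split_ifs with h
    · exact Real.continuous_exp.comp (continuous_apply _)
    · exact continuous_const
  let H : (E → ℝ) × stdSimplex ℝ Y → Y → X → ℝ :=
    fun p y x' => ∑ y' ∈ fiber κ x', M p.1 y y' * p.2.1 y'
  have hHc : ∀ y x', Continuous fun p => H p y x' := fun y x' =>
    continuous_finsetSum _ fun y' _ => ((hMc y y').comp continuous_fst).mul
      ((continuous_apply y').comp (continuous_subtype_val.comp continuous_snd))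
  have hvc : ∀ y, Continuous fun p : (E → ℝ) × stdSimplex ℝ Y => p.2.1 y := fun y =>
    (continuous_apply y).comp (continuous_subtype_val.comp continuous_snd)
  have hHsum : ∀ p y, ∑ x', H p y x' = (M p.1).mulVec p.2.1 y := fun p y =>
    sum_fiber_sum κ fun y' => M p.1 y y' * p.2.1 y'
  -- For `v` in the simplex, an eigenvalue equals the total mass of the image of `v`.
  let C : Set ((E → ℝ) × stdSimplex ℝ Y) :=
    {p | (∀ y, ∑ x', H p y x' = (∑ z, ∑ x', H p z x') * p.2.1 y) ∧
      ∀ y₁ y₂ x', κ y₁ = κ y₂ → p.2.1 y₂ * H p y₁ x' = p.2.1 y₁ * H p y₂ x'}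
  have hC : IsClosed C := by
    simp only [C, Set.ofPred_and, Set.ofPred_forall]
    refine IsClosed.inter ?_ ?_
    · exact isClosed_iInter fun y => isClosed_eq (continuous_finsetSum _ fun _ _ => hHc _ _)
        ((continuous_finsetSum _ fun _ _ => continuous_finsetSum _ fun _ _ => hHc _ _).mul (hvc y))
    · exact isClosed_iInter fun y₁ => isClosed_iInter fun y₂ => isClosed_iInter fun x' =>
        isClosed_iInter fun _ => isClosed_eq ((hvc _).mul (hHc _ _)) ((hvc _).mul (hHc _ _))
  convert isClosedMap_fst_of_compactSpace (X := E → ℝ) (Y := stdSimplex ℝ Y) C hC using 1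
  ext w
  constructor
  · rintro ⟨P, hP, hn⟩
    obtain ⟨⟨ρ, v⟩, ⟨hρ, hv, hev⟩, hpP⟩ := exists_isPerronPair_of_sub_log_mem hP.1 hn
    rw [mem_lumpableFamily_iff_sums hκ] at hP
    simp only at hρ hv hev hpP
    set t := ∑ y, v y
    have ht : 0 < t := sum_pos (fun y _ => hv y) univ_nonempty
    have hu : t⁻¹ • v ∈ stdSimplex ℝ Y := by
      refine ⟨fun y => mul_nonneg (inv_pos.mpr ht).le (hv y).le, ?_⟩
      simp only [Pi.smul_apply, smul_eq_mul, ← mul_sum]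
      exact inv_mul_cancel₀ ht.ne'
    refine ⟨(w, ⟨t⁻¹ • v, hu⟩), ⟨?_, ?_⟩, rfl⟩
    · have h1 : ∀ y, (M w).mulVec (t⁻¹ • v) y = ρ * (t⁻¹ • v) y := fun y => by
        have h2 : (M w).mulVec v y = ρ * v y := congrFun hev y
        rw [Matrix.mulVec_smul, Pi.smul_apply, Pi.smul_apply, h2, smul_eq_mul, smul_eq_mul,
          mul_left_comm]
      simp only [hHsum, h1, ← mul_sum, hu.2, mul_one, implies_true]
    · have hH : ∀ y x', H (w, ⟨t⁻¹ • v, hu⟩) y x' =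
          ρ * (t⁻¹ • v) y * blockSum E κ y x' P := by
        intro y x'
        rw [blockSum_apply, mul_sum]
        refine sum_congr rfl fun y' _ => ?_
        by_cases h : (y, y') ∈ E
        · simp only [M, edgeMatrix_of_mem h, ← hpP, Pi.smul_apply, smul_eq_mul]
          have := (hv y).ne'
          field_simp
        · simp only [M, edgeMatrix_of_notMem h, zero_mul, mul_zero]
      intro y₁ y₂ x' hy
      rw [hH, hH, hP.2.2 y₁ y₂ x' hy]
      simp only
      ring
  · rintro ⟨⟨w, ⟨v, hv⟩⟩, ⟨h1, h2⟩, rfl⟩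
    simp only [hHsum] at h1 h2
    set ρ := ∑ z, (M w).mulVec v z
    have hv0 : ∀ y, 0 < v y := by
      by_contra! hex
      obtain ⟨y, hy⟩ := hex
      have hy0 : v y = 0 := le_antisymm hy (hv.1 y)
      have hall : ∀ z, v z = 0 := by
        intro z
        induction hE y z with
        | refl => exact hy0
        | @tail a b _ hab ih =>
          have h3 : ∑ y', M w a y' * v y' = 0 := (h1 a).trans (by rw [ih, mul_zero])
          have h4 := (sum_eq_zero_iff_of_nonneg fun y' _ => mul_nonneg (hM0 w a y') (hv.1 y')).mp
            h3 b (mem_univ b)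
          exact (mul_eq_zero.mp h4).resolve_left ((hMpos w a b).mpr hab).ne'
      have := hv.2
      simp [hall] at this
    have hρ : 0 < ρ := by
      obtain ⟨⟨y, y'⟩, he⟩ := hEne
      have h3 : 0 < (M w).mulVec v y := sum_pos' (fun z _ => mul_nonneg (hM0 w y z) (hv0 z).le)
        ⟨y', mem_univ _, mul_pos ((hMpos w y y').mpr he) (hv0 y')⟩
      rw [h1] at h3
      exact pos_of_mul_pos_left h3 (hv0 y).le
    have hpos : ∀ e : E, 0 < Real.exp (w e) := fun e => Real.exp_pos _
    have hp : IsPerronPair E (fun e => Real.exp (w e)) (ρ, v) := ⟨hρ, hv0, funext h1⟩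
    have hmem := normalize_mem_stochasticFamily hpos hp
    refine ⟨_, (mem_lumpableFamily_iff hκ).mpr ⟨hmem, mem_positiveLumpable_iff.mpr
      ⟨hmem.1, fun y₁ y₂ x' hy => ?_⟩⟩, ?_⟩
    · have hb : ∀ y, blockSum E κ y x'
          (fun e : E => Real.exp (w e) * v e.1.2 / (ρ * v e.1.1)) =
          H (w, ⟨v, hv⟩) y x' / (ρ * v y) := fun y => by
        rw [blockSum_apply, sum_div]
        refine sum_congr rfl fun y' _ => ?_
        by_cases h : (y, y') ∈ E
        · simp only [M, edgeMatrix_of_mem h]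
        · simp only [M, edgeMatrix_of_notMem h, zero_mul, zero_div]
      rw [hb, hb, div_eq_div_iff (mul_pos hρ (hv0 _)).ne' (mul_pos hρ (hv0 _)).ne']
      linear_combination ρ * h2 y₁ y₂ x' hy
    · have h := log_normalize_sub_mem_antiShift hpos hp
      simp only [Real.log_exp] at h
      exact h

/-- `log 𝒲_κ + 𝒩` fills `span 𝒢_κ + 𝒩` exactly when the dimensions agree. The chart is a smooth
parametrization of the former, so it cannot fill a space of larger dimension; if the dimensions
agree, then `log 𝒲_κ + 𝒩` is open by the inverse function theorem and closed, hence everything. -/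
lemma forall_mem_logSaturation_iff [Nonempty Y] (hE : StronglyConnected E)
    (hκ : Function.Surjective κ) (hne : (lumpableFamily E κ).Nonempty) :
    (∀ w ∈ logSpan E κ, w ∈ logSaturation E (lumpableFamily E κ)) ↔
      Module.finrank ℝ (logSpan E κ) =
        Module.finrank ℝ (tangentSpace E κ) + Fintype.card Y := by
  obtain ⟨P₀, hP₀⟩ := hne
  rw [← finrank_antiShift hE ⟨P₀, hP₀.1⟩, ← Module.finrank_prod]
  -- A linear projection onto `span 𝒢_κ + 𝒩` turns the chart into a map between normed spaces.
  obtain ⟨π, hπ⟩ := (logSpan E κ).subtype.exists_leftInverse_of_injective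
    (Submodule.ker_subtype _)
  have hπv : ∀ v : logSpan E κ, π v = v := fun v => LinearMap.congr_fun hπ v
  let πc : (E → ℝ) →L[ℝ] logSpan E κ := π.toContinuousLinearMap
  constructor
  · intro h
    refine le_antisymm ?_ ?_
    · by_contra! hlt
      have hsurj : (fun x => πc (logChart κ P₀ x)) ''
          {x : tangentSpace E κ × antiShift E | ∀ e, 0 < P₀ e + x.1.1 e} = Set.univ := by
        refine Set.eq_univ_of_forall fun w => ?_
        obtain ⟨x, hx, hxw⟩ := exists_logChart_eq hκ hP₀ (h w w.2)
        exact ⟨x, hx, by simp only [hxw]; exact hπv w⟩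
      have hdense := (πc.contDiff.comp_contDiffOn
        (contDiffOn_logChart (κ := κ) P₀)).dense_compl_image_of_dimH_lt_finrank
        (convex_logChart_domain P₀) subset_rfl
        ((dimH_mono (Set.subset_univ _)).trans_lt (by
          rw [Real.dimH_univ_eq_finrank]
          exact_mod_cast hlt))
      have hempty : ((fun x => πc (logChart κ P₀ x)) ''
          {x : tangentSpace E κ × antiShift E | ∀ e, 0 < P₀ e + x.1.1 e})ᶜ = ∅ := by
        rw [hsurj, Set.compl_univ]
      exact hdense.nonempty.ne_empty hempty
    · rw [← LinearMap.finrank_range_of_inj (logChartDeriv_injective (κ := κ) hE hP₀.1)]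
      exact Submodule.finrank_mono (range_logChartDeriv_le hκ hP₀)
  · intro hdim
    have hEne := nonempty_of_mem_stochasticFamily hP₀.1
    let A : Set (logSpan E κ) := {w | (w : E → ℝ) ∈ logSaturation E (lumpableFamily E κ)}
    have hclosed : IsClosed A :=
      (isClosed_logSaturation hE hκ hEne).preimage continuous_subtype_val
    have hopen : IsOpen A := by
      rw [isOpen_iff_mem_nhds]
      rintro w ⟨P, hP, hn⟩
      have hrange : LinearMap.range (logChartDeriv κ P) = logSpan E κ :=
        Submodule.eq_of_le_of_finrank_eq (range_logChartDeriv_le hκ hP)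
          (by rw [LinearMap.finrank_range_of_inj (logChartDeriv_injective hE hP.1), hdim])
      let x₀ : tangentSpace E κ × antiShift E := (0, ⟨_, hn⟩)
      have hderiv := (πc.hasStrictFDerivAt (x := logChart κ P x₀)).comp x₀
        (hasStrictFDerivAt_logChart (κ := κ) hP.1.1 ⟨_, hn⟩)
      have hmap := hderiv.map_nhds_eq_of_surj (LinearMap.range_eq_top.mpr fun u => by
        obtain ⟨x, hx⟩ := LinearMap.mem_range.mp (hrange.ge u.2)
        exact ⟨x, (congrArg π hx).trans (hπv u)⟩)
      have hx₀ : logChart κ P x₀ = w := by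
        ext e
        simp [logChart, x₀]
      have hw : πc (logChart κ P x₀) = w := by
        rw [hx₀]
        exact hπv w
      rw [hw] at hmap
      rw [← hmap, Filter.mem_map]
      refine Filter.mem_of_superset ((isOpen_logChart_domain P).mem_nhds fun e => ?_) fun x hx => ?_
      · simpa [x₀] using hP.1.1 e
      · have hm := logChart_mem_logSaturation hκ hP hx
        have hpx : ((πc (logChart κ P x) : logSpan E κ) : E → ℝ) = logChart κ P x :=
          congrArg Subtype.val (hπv ⟨_, logSaturation_subset_logSpan hκ hm⟩)
        change ((πc (logChart κ P x) : logSpan E κ) : E → ℝ) ∈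
          logSaturation E (lumpableFamily E κ)
        rwa [hpx]
    have hP₀A : (fun e => Real.log (P₀ e)) ∈ logSaturation E (lumpableFamily E κ) :=
      ⟨P₀, hP₀, by rw [sub_self]; exact zero_mem _⟩
    have huniv := IsClopen.eq_univ ⟨hclosed, hopen⟩
      ⟨⟨_, logSaturation_subset_logSpan hκ hP₀A⟩, hP₀A⟩
    exact fun w hw => (huniv ▸ Set.mem_univ (⟨w, hw⟩ : logSpan E κ) : (⟨w, hw⟩ : logSpan E κ) ∈ A)

end Saturation

/-! ### Rank of a rational matrix -/

/-- The rank of a matrix does not change under an extension of fields. -/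
lemma rank_eq_finrank_span_algebraMap {ι m K L : Type*} [Finite ι] [Fintype m] [Field K]
    [Field L] [Algebra K L] (v : ι → m → K) (w : ι → m → L)
    (h : ∀ i e, algebraMap K L (v i e) = w i e) :
    (Matrix.of v).rank = Module.finrank L (Submodule.span L (Set.range w)) := by
  obtain rfl : (fun i => algebraMap K L ∘ v i) = w := funext fun i => funext fun e => h i e
  rw [Matrix.rank_eq_finrank_span_row]
  change Module.finrank K (Submodule.span K (Set.range v)) = _
  obtain ⟨σ, a, ha, hspan, hind⟩ := exists_linearIndependent' K v
  have : Finite σ := Finite.of_injective a ha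
  have : Fintype σ := Fintype.ofFinite σ
  have hind' : LinearIndependent L (fun i => algebraMap K L ∘ (v ∘ a) i) :=
    linearIndependent_algebraMap_comp_iff.mpr hind
  have hspan' : Submodule.span L (Set.range fun i => algebraMap K L ∘ v i) =
      Submodule.span L (Set.range fun i => algebraMap K L ∘ (v ∘ a) i) := by
    refine le_antisymm (Submodule.span_le.mpr ?_) (Submodule.span_mono ?_)
    · rintro _ ⟨i, rfl⟩
      have hi : v i ∈ Submodule.span K (Set.range (v ∘ a)) :=
        hspan ▸ Submodule.subset_span ⟨i, rfl⟩
      obtain ⟨g, hg⟩ := (Submodule.mem_span_range_iff_exists_fun K).mp hi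
      refine (Submodule.mem_span_range_iff_exists_fun L).mpr ⟨fun j => algebraMap K L (g j), ?_⟩
      ext e
      simp [← hg, Algebra.smul_def]
    · rintro _ ⟨i, rfl⟩
      exact ⟨a i, rfl⟩
  rw [hspan', ← hspan, finrank_span_eq_card hind, finrank_span_eq_card hind']

lemma rank_criterionMatrix {X Y : Type*} [Fintype Y] [DecidableEq X] [DecidableEq Y]
    (E : Finset (Y × Y)) (κ : Y → X) (a : Y → X → Y) (yStar : Y) :
    (criterionMatrix E κ a yStar).rank =
      Module.finrank ℝ ↥(Submodule.span ℝ (Set.range (lumpableBasis ℝ E κ a)) ⊔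
        Submodule.span ℝ (Set.range (antiShiftBasis ℝ E yStar))) := by
  rw [← Submodule.span_union, ← Set.Sum.elim_range]
  refine rank_eq_finrank_span_algebraMap _ _ ?_
  rintro ((p | e₀) | (_ | y₀)) e <;>
    simp only [Sum.elim_inl, Sum.elim_inr, lumpableBasis, antiShiftBasis, map_sub, map_one,
      apply_ite (algebraMap ℚ ℝ), map_zero]

end Lumping

theorem mainTheorem1 {X Y : Type*} [Fintype X] [Fintype Y] [DecidableEq X] [DecidableEq Y]
    [Nonempty Y] (E : Finset (Y × Y)) (hE : StronglyConnected E)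
    (κ : Y → X) (hκ : Function.Surjective κ)
    (hne : (lumpableFamily E κ).Nonempty) :
    (IsEFamily E (lumpableFamily E κ) ↔
      (Module.finrank ℝ ↥(Submodule.span ℝ (logLumpable E κ) ⊔ antiShift E) : ℤ) =
        E.card + Fintype.card Y + (lumpedEdges E κ).card - Fintype.card X
          - ∑ p ∈ lumpedEdges E κ, ((fiber κ p.1).card : ℤ)) ∧
    (∃ a : Y → X → Y, IsAnchorChoice E κ a) ∧
    ∀ a : Y → X → Y, IsAnchorChoice E κ a → ∀ yStar : Y,
      LinearIndependent ℝ (lumpableBasis ℝ E κ a) ∧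
      Submodule.span ℝ (Set.range (lumpableBasis ℝ E κ a)) =
        Submodule.span ℝ (logLumpable E κ) ∧
      LinearIndependent ℝ (antiShiftBasis ℝ E yStar) ∧
      Submodule.span ℝ (Set.range (antiShiftBasis ℝ E yStar)) = antiShift E ∧
      (IsEFamily E (lumpableFamily E κ) ↔
        ((criterionMatrix E κ a yStar).rank : ℤ) =
          E.card + Fintype.card Y + (lumpedEdges E κ).card - Fintype.card X
            - ∑ p ∈ lumpedEdges E κ, ((fiber κ p.1).card : ℤ)) := by
  have hdim : IsEFamily E (lumpableFamily E κ) ↔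
      (Module.finrank ℝ ↥(Submodule.span ℝ (logLumpable E κ) ⊔ antiShift E) : ℤ) =
        E.card + Fintype.card Y + (lumpedEdges E κ).card - Fintype.card X
          - ∑ p ∈ lumpedEdges E κ, ((fiber κ p.1).card : ℤ) := by
    change _ ↔ (Module.finrank ℝ (logSpan E κ) : ℤ) = _
    rw [isEFamily_lumpableFamily_iff hE hκ hne, forall_mem_logSaturation_iff hE hκ hne,
      ← Nat.cast_sum]
    have h := finrank_tangentSpace hκ hne
    omega
  obtain ⟨P, hP⟩ := hne
  have hpos : (positiveLumpable E κ).Nonempty := ⟨P, ((mem_lumpableFamily_iff hκ).mp hP).2⟩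
  refine ⟨hdim, exists_isAnchorChoice hpos, fun a ha yStar =>
    ⟨linearIndependent_lumpableBasis ha, span_lumpableBasis hκ ha hpos,
      linearIndependent_antiShiftBasis hE ⟨P, hP.1⟩ yStar, span_antiShiftBasis yStar, ?_⟩⟩
  rw [rank_criterionMatrix, span_lumpableBasis hκ ha hpos, span_antiShiftBasis]
  exact hdim
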